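/- **Conventions.** All logarithms have base $2$ and all local Hilbert spaces are finite-dimensional. For an $N$-partite state $\rho$ let $\mathrm{SEP}$ be the set of fully separable states (convex combinations of product states $\sigma^1\otimes\cdots\otimes\sigma^N$), and let - $G(\rho)=-2\log\Lambda(\rho)$ with $\Lambda^2(\rho)=\max_{\sigma\in\mathrm{SEP}}\operatorname{tr}(\rho\sigma)$ (geometric measure, GM); - $E_{\mathrm R}(\rho)=\min_{\sigma\in\mathrm{SEP}}S(\rho\|\sigma)$ with $S(\rho\|\sigma)=\operatorname{tr}\rho(\log\rho-\log\sigma)$, which is $+\infty$ unless $\operatorname{supp}\rho\subseteq\operatorname{supp}\sigma$ (relative entropy of entanglement, REE); - $R_{\mathrm L}(\rho)=\log(1+R_{\mathrm g}(\rho))$ with $R_{\mathrm g}(\rho)=\min\{t\ge 0:\ \exists\text{ a state }\Delta,\ \tfrac{\rho+t\Delta}{1+t}\in\mathrm{SEP}\}$ (logarithmic global robustness, LGR). A tensor product of $N$-partite states is again regarded as $N$-partite, the $l$-th party holding the $l$-th subsystem of every factor. For $E\in\{G,E_{\mathrm R},R_{\mathrm L}\}$ put $E^\infty(\rho)=\lim_{n\to\infty}\frac1nE(\rho^{\otimes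 n})$. We say that $E$ of $\rho$ is *additive* if $E^\infty(\rho)=E(\rho)$ (the limit existing), and *strong additive* if $E(\rho\otimes\sigma)=E(\rho)+E(\sigma)$ for every $N$-partite state $\sigma$ (of arbitrary local dimensions). For $N\ge 1$ and $\vec k=(k_0,\dots,k_{d-1})$ with non-negative integers $k_j$ and $\sum_j k_j=N$, the generalized Dicke state $|N,\vec k\rangle\in(\mathbb C^d)^{\otimes N}$ is $$|N,\vec k\rangle=\Bigl(\tfrac{N!}{\prod_j k_j!}\Bigr)^{-1/2}\sum_{x}|x_1\cdots x_N\rangle ,$$ where $x$ runs over all distinct words in which each symbol $j$ occurs exactly $k_j$ times. Put ($0^0=1$, $0\log 0=0$) $$v(N,\vec k)=-\log\Bigl[\frac{N!}{\prod_j k_j!}\prod_j\Bigl(\frac{k_j}{N}\Bigr)^{k_j}\Bigr],\qquad H\Bigl(\frac{\vec k}{N}\Bigr)=-\sum_j\frac{k_j}{N}\log\frac{k_j}{N}.$$ **Proposition.** GM of $|N,\vec k\rangle$ is strong additive, REE and LGR of $|N,\vec k\rangle$ are additive, and $$R_{\mathrm L}^\infty(|N,\vec k\rangle)=E_{\mathrm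 R}^\infty(|N,\vec k\rangle)=G^\infty(|N,\vec k\rangle)=v(N,\vec k).$$ Moreover, if $\widetilde\rho_{N,\vec k}$ is an $(N-1)$-partite reduced state of $|N,\vec k\rangle$, obtained by tracing out any one of the parties, then REE of $\widetilde\rho_{N,\vec k}$ is additive and $$E_{\mathrm R}^\infty(\widetilde\rho_{N,\vec k})=E_{\mathrm R}(\widetilde\rho_{N,\vec k})=v(N,\vec k)-H\Bigl(\frac{\vec k}{N}\Bigr).$$ -/

import Mathlib

noncomputable section

namespace MultipartiteEntanglement

open scoped Matrix Nat Topology ComplexOrder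
open Filter

/-- A quantum state (density matrix) on the finite-dimensional Hilbert space `ℂⁿ`. -/
def IsState {n : Type} [Fintype n] (ρ : Matrix n n ℂ) : Prop :=
  ρ.PosSemidef ∧ ρ.trace = 1

/-- Operators on `⨂_{l ∈ P} ℂ^{ι l}`, written as matrices in the computational (product) basis.
`P` is the finite set of parties and `ι l` labels the basis of the local space of party `l`. -/
abbrev Op {P : Type} (ι : P → Type) : Type :=
  Matrix (∀ l, ι l) (∀ l, ι l) ℂ

section Separable

variable {P : Type} [Fintype P] [DecidableEq P]
variable {ι : P → Type} [∀ l, Fintype (ι l)] [∀ l, DecidableEq (ι l)]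

/-- The product operator `⨂_{l} A l`. -/
def productOp (A : ∀ l, Matrix (ι l) (ι l) ℂ) : Op ι :=
  fun x y => ∏ l, A l (x l) (y l)

variable (ι) in
/-- The fully separable states: convex combinations of product states. -/
def SEP : Set (Op ι) :=
  convexHull ℝ {σ | ∃ A : ∀ l, Matrix (ι l) (ι l) ℂ, (∀ l, IsState (A l)) ∧ σ = productOp A}

/-- The maximal overlap `Λ(ρ)`, where `Λ²(ρ) = max_{σ ∈ SEP} tr(ρσ)`. -/
def maxOverlap (ρ : Op ι) : ℝ :=
  √(sSup {r : ℝ | ∃ σ ∈ SEP ι, r = (ρ * σ).trace.re})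

end Separable

/-- The quantum relative entropy `S(ρ‖σ) = tr ρ (log₂ ρ - log₂ σ)`, which is `+∞` unless the
support of `ρ` is contained in that of `σ`, that is, unless `ker σ ⊆ ker ρ`.
The functional calculus uses `log₂ 0 = 0`, so that each logarithm is taken on the support. -/
def relativeEntropy {n : Type} [Fintype n] [DecidableEq n] (ρ σ : Matrix n n ℂ) : EReal :=
  open Classical in
  if ∀ v : n → ℂ, σ *ᵥ v = 0 → ρ *ᵥ v = 0 then
    (((ρ * (cfc (Real.logb 2) ρ - cfc (Real.logb 2) σ)).trace.re : ℝ) : EReal)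
  else ⊤

/-- The geometric measure `G(ρ) = -2 log₂ Λ(ρ)`. -/
def GM {P : Type} [Fintype P] [DecidableEq P]
    (ι : P → Type) [∀ l, Fintype (ι l)] [∀ l, DecidableEq (ι l)] (ρ : Op ι) : ℝ :=
  -2 * Real.logb 2 (maxOverlap ρ)

/-- The relative entropy of entanglement `E_R(ρ) = min_{σ ∈ SEP} S(ρ‖σ)`. -/
def REE {P : Type} [Fintype P] [DecidableEq P]
    (ι : P → Type) [∀ l, Fintype (ι l)] [∀ l, DecidableEq (ι l)] (ρ : Op ι) : EReal :=
  ⨅ σ ∈ SEP ι, relativeEntropy ρ σ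

/-- The global robustness
`R_g(ρ) = min {t ≥ 0 | ∃ a state Δ with (ρ + tΔ) / (1 + t) ∈ SEP}`. -/
def globalRobustness {P : Type} [Fintype P] [DecidableEq P]
    (ι : P → Type) [∀ l, Fintype (ι l)] [∀ l, DecidableEq (ι l)] (ρ : Op ι) : ℝ :=
  sInf {t : ℝ | 0 ≤ t ∧ ∃ Δ : Op ι, IsState Δ ∧ (1 + t)⁻¹ • (ρ + t • Δ) ∈ SEP ι}

/-- The logarithmic global robustness `R_L(ρ) = log₂ (1 + R_g(ρ))`. -/
def LGR {P : Type} [Fintype P] [DecidableEq P]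
    (ι : P → Type) [∀ l, Fintype (ι l)] [∀ l, DecidableEq (ι l)] (ρ : Op ι) : ℝ :=
  Real.logb 2 (1 + globalRobustness ι ρ)

/-- `ρ ⊗ σ` as a state over the same parties: party `l` holds both of its subsystems. -/
def tensor {P : Type} {ι κ : P → Type} (ρ : Op ι) (σ : Op κ) : Op (fun l => ι l × κ l) :=
  fun x y => ρ (fun l => (x l).1) (fun l => (y l).1) * σ (fun l => (x l).2) (fun l => (y l).2)

/-- `ρ^{⊗n}` as a state over the same parties: party `l` holds its subsystem of every copy. -/
def copies {P : Type} {ι : P → Type} (ρ : Op ι) (n : ℕ) : Op (fun l => Fin n → ι l) :=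
  fun x y => ∏ m : Fin n, ρ (fun l => x l m) (fun l => y l m)

section Additivity

variable {P : Type} [Fintype P] [DecidableEq P] {V : Type}
variable (E : ∀ (κ : P → Type) [∀ l, Fintype (κ l)] [∀ l, DecidableEq (κ l)], Op κ → V)
variable {ι : P → Type} [∀ l, Fintype (ι l)] [∀ l, DecidableEq (ι l)]

/-- `E^∞(ρ) = L`: the limit `lim_{n → ∞} E(ρ^{⊗n}) / n` exists and equals `L`. -/
def HasAsymptotic [Div V] [NatCast V] [TopologicalSpace V] (ρ : Op ι) (L : V) : Prop :=
  Tendsto (fun n : ℕ => E (fun l => Fin n → ι l) (copies ρ n) / (n : V)) atTop (𝓝 L)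

/-- `E` of `ρ` is additive: `E^∞(ρ) = E(ρ)`. -/
def IsAdditive [Div V] [NatCast V] [TopologicalSpace V] (ρ : Op ι) : Prop :=
  HasAsymptotic E ρ (E ι ρ)

/-- `E` of `ρ` is strong additive: `E(ρ ⊗ σ) = E(ρ) + E(σ)` for every state `σ` over the same
parties, with arbitrary finite local dimensions. -/
def IsStrongAdditive [Add V] (ρ : Op ι) : Prop :=
  ∀ (κ : P → Type) [∀ l, Fintype (κ l)] [∀ l, DecidableEq (κ l)] (σ : Op κ), IsState σ →
    E (fun l => ι l × κ l) (tensor ρ σ) = E ι ρ + E κ σ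

end Additivity

/-- The state of the remaining parties after tracing out party `i`. -/
def reduced {P : Type} [DecidableEq P] {ι : P → Type} [∀ l, Fintype (ι l)] (i : P) (ρ : Op ι) :
    Op (fun l : {l : P // l ≠ i} => ι l) :=
  fun x y => ∑ a : ι i, ρ ((Equiv.piSplitAt i ι).symm (a, x)) ((Equiv.piSplitAt i ι).symm (a, y))

/-- The vector `|N, k⟩` in `(ℂ^d)^{⊗N}`: the sum of all basis vectors `|x₁ … x_N⟩` that are
rearrangements of the word in which every symbol `j` occurs `k j` times, divided by the square root
of `N! / ∏ⱼ (k j)!`. -/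
def dickeVec (N : ℕ) {d : ℕ} (k : Fin d → ℕ) (x : Fin N → Fin d) : ℂ :=
  if ∀ j, (Finset.univ.filter fun l => x l = j).card = k j then
    ((1 / √((N ! : ℝ) / ∏ j, ((k j)! : ℝ)) : ℝ) : ℂ)
  else 0

/-- The generalized Dicke state, as the density matrix `|N, k⟩⟨N, k|`. -/
def dicke (N : ℕ) {d : ℕ} (k : Fin d → ℕ) : Op (fun _ : Fin N => Fin d) :=
  Matrix.vecMulVec (dickeVec N k) (star (dickeVec N k))

/-- `-log₂ [ (N! / ∏ⱼ (k j)!) ∏ⱼ (k j / N)^(k j) ]`. -/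
def dickeValue (N : ℕ) {d : ℕ} (k : Fin d → ℕ) : ℝ :=
  -Real.logb 2 ((N ! : ℝ) / (∏ j, ((k j)! : ℝ)) * ∏ j, ((k j : ℝ) / (N : ℝ)) ^ k j)

/-- The Shannon entropy (in bits) of a probability vector. -/
def shannonEntropy {d : ℕ} (p : Fin d → ℝ) : ℝ :=
  -∑ j, p j * Real.logb 2 (p j)

end MultipartiteEntanglement

end

open MultipartiteEntanglement

/-!
If a state `ρ` overlaps every product state in at most `c`, and some separable `σ` satisfies
`σ ρ = c ρ`, then `σ` is optimal for all three measures. The overlap with `σ` equals `c`, so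
`GM ρ = -log c`. On the range of `ρ` the logarithm of `σ` is the constant `log c`, while the
concavity of the logarithm gives `tr ρ log τ ≤ log tr ρτ ≤ log c` for every separable `τ`; hence
`REE ρ = -S(ρ) - log c`. If `ρ` is a projector, then `σ - c ρ` is positive, so `σ` is a mixture of
`ρ` with weight `c`, and `LGR ρ = -log c`.

Such a pair passes to tensor powers when the entries of `ρ` are non-negative: the overlap of `ρ ⊗ τ`
with a product vector only grows when each local vector is replaced by its partial norms over the
second factor, so the bound is multiplicative.

For `ρ = |N, k⟩⟨N, k|` the product bound follows from Banach's theorem that a symmetric multilinear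
form attains its norm on the diagonal, together with the maximum likelihood inequality
`∏ⱼ pⱼ ^ kⱼ ≤ ∏ⱼ (kⱼ / N) ^ kⱼ`. The optimal `σ` is the average of the `N`-th power of
`∑ⱼ √(kⱼ / N) |j⟩` over independent phases of its coordinates. Both survive tracing out a party,
which turns `ρ` into the mixture of the states `|N - 1, k - eⱼ⟩` with the weights `kⱼ / N`.
-/

noncomputable section

namespace MultipartiteEntanglement

open scoped Matrix Nat Topology ComplexOrder
open Filter

section LinearAlgebra

theorem posSemidef_smul_of_nonneg {n : Type*} {A : Matrix n n ℂ} (hA : A.PosSemidef) {r : ℝ}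
    (hr : 0 ≤ r) : (r • A).PosSemidef := by
  rw [← algebraMap_smul ℂ r A]
  exact hA.smul (Complex.zero_le_real.mpr hr)

variable {n : Type*} [Fintype n]

theorem sum_norm_sq_nonneg (v : n → ℂ) : 0 ≤ ∑ j, ‖v j‖ ^ 2 :=
  Finset.sum_nonneg fun _ _ => by positivity

theorem exists_eq_smul_unit {v : n → ℂ} (hv : ∑ j, ‖v j‖ ^ 2 ≠ 0) :
    ∃ u : n → ℂ, ∑ j, ‖u j‖ ^ 2 = 1 ∧ v = (√(∑ j, ‖v j‖ ^ 2) : ℂ) • u := by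
  set r : ℝ := √(∑ j, ‖v j‖ ^ 2)
  have hr2 : r ^ 2 = ∑ j, ‖v j‖ ^ 2 := Real.sq_sqrt (sum_norm_sq_nonneg v)
  have hr0 : (r : ℂ) ≠ 0 := fun hr =>
    hv (by rw [← hr2, Complex.ofReal_eq_zero.mp hr, zero_pow two_ne_zero])
  refine ⟨(r : ℂ)⁻¹ • v, ?_, (smul_inv_smul₀ hr0 v).symm⟩
  simp only [Pi.smul_apply, norm_smul, mul_pow, ← Finset.mul_sum, ← hr2, norm_inv,
    Complex.norm_real, Real.norm_eq_abs, inv_pow, sq_abs]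
  exact inv_mul_cancel₀ (hr2 ▸ hv)

theorem star_dotProduct_self (v : n → ℂ) : star v ⬝ᵥ v = ((∑ j, ‖v j‖ ^ 2 : ℝ) : ℂ) := by
  simp [dotProduct, Complex.conj_mul']

theorem trace_vecMulVec_star (v : n → ℂ) :
    (Matrix.vecMulVec v (star v)).trace = ((∑ j, ‖v j‖ ^ 2 : ℝ) : ℂ) := by
  rw [Matrix.trace_vecMulVec, dotProduct_comm, star_dotProduct_self]

theorem trace_mul_vecMulVec_star (ρ : Matrix n n ℂ) (v : n → ℂ) :
    (ρ * Matrix.vecMulVec v (star v)).trace = star v ⬝ᵥ ρ *ᵥ v := by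
  rw [Matrix.mul_vecMulVec, Matrix.trace_vecMulVec, dotProduct_comm]

theorem star_dotProduct_vecMulVec_star_mulVec (u v w : n → ℂ) :
    star u ⬝ᵥ Matrix.vecMulVec w (star w) *ᵥ v = star (star w ⬝ᵥ u) * (star w ⬝ᵥ v) := by
  rw [Matrix.vecMulVec_mulVec, op_smul_eq_smul, dotProduct_smul, smul_eq_mul, mul_comm,
    Matrix.star_dotProduct]

theorem re_dotProduct_vecMulVec_star_mulVec (v w : n → ℂ) :
    (star v ⬝ᵥ Matrix.vecMulVec w (star w) *ᵥ v).re = ‖star w ⬝ᵥ v‖ ^ 2 := by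
  rw [star_dotProduct_vecMulVec_star_mulVec, Complex.star_def, Complex.conj_mul',
    ← Complex.ofReal_pow, Complex.ofReal_re]

theorem re_dotProduct_mulVec_smul (ρ : Matrix n n ℂ) (r : ℂ) (v : n → ℂ) :
    (star (r • v) ⬝ᵥ ρ *ᵥ (r • v)).re = ‖r‖ ^ 2 * (star v ⬝ᵥ ρ *ᵥ v).re := by
  rw [star_smul, smul_dotProduct, Matrix.mulVec_smul, dotProduct_smul, smul_smul, Complex.star_def,
    Complex.conj_mul', smul_eq_mul, ← Complex.ofReal_pow, Complex.re_ofReal_mul]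

theorem re_dotProduct_mulVec_nonneg {ρ : Matrix n n ℂ} (hρ : ρ.PosSemidef) (v : n → ℂ) :
    0 ≤ (star v ⬝ᵥ ρ *ᵥ v).re :=
  (Complex.le_def.mp (hρ.dotProduct_mulVec_nonneg v)).1

theorem trace_mul_nonneg {ρ σ : Matrix n n ℂ} (hρ : ρ.PosSemidef) (hσ : σ.PosSemidef) :
    0 ≤ (ρ * σ).trace := by
  obtain ⟨m, w, rfl⟩ := Matrix.posSemidef_iff_eq_sum_vecMulVec.mp hσ
  rw [Matrix.mul_sum, Matrix.trace_sum]
  refine Finset.sum_nonneg fun i _ => ?_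
  rw [trace_mul_vecMulVec_star]
  exact hρ.dotProduct_mulVec_nonneg (w i)

theorem re_trace_mul_nonneg {ρ σ : Matrix n n ℂ} (hρ : ρ.PosSemidef) (hσ : σ.PosSemidef) :
    0 ≤ (ρ * σ).trace.re :=
  (Complex.le_def.mp (trace_mul_nonneg hρ hσ)).1

/- Cauchy–Schwarz: for a rank-one decomposition of `σ` the form is the inner product of the vectors
of coefficients. -/
theorem norm_dotProduct_mulVec_sq_le {σ : Matrix n n ℂ} (hσ : σ.PosSemidef) (u v : n → ℂ) :
    ‖star u ⬝ᵥ σ *ᵥ v‖ ^ 2 ≤ (star u ⬝ᵥ σ *ᵥ u).re * (star v ⬝ᵥ σ *ᵥ v).re := by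
  obtain ⟨m, w, rfl⟩ := Matrix.posSemidef_iff_eq_sum_vecMulVec.mp hσ
  simp only [Matrix.sum_mulVec, dotProduct_sum, Complex.re_sum, re_dotProduct_vecMulVec_star_mulVec]
  simp only [star_dotProduct_vecMulVec_star_mulVec]
  calc ‖∑ i, star (star (w i) ⬝ᵥ u) * (star (w i) ⬝ᵥ v)‖ ^ 2
      ≤ (∑ i, ‖star (w i) ⬝ᵥ u‖ * ‖star (w i) ⬝ᵥ v‖) ^ 2 := by
        gcongr
        exact (norm_sum_le _ _).trans_eq (by simp only [norm_mul, norm_star])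
    _ ≤ _ := Finset.sum_mul_sq_le_sq_mul_sq _ _ _

end LinearAlgebra

section FunctionalCalculus

theorem aeval_mul_of_mul_eq_smul {R A : Type*} [CommSemiring R] [Semiring A] [Algebra R A]
    {a b : A} {c : R} (h : a * b = c • b) (p : Polynomial R) :
    Polynomial.aeval a p * b = p.eval c • b := by
  induction p using Polynomial.induction_on' with
  | add p q hp hq => rw [map_add, add_mul, hp, hq, Polynomial.eval_add, add_smul]
  | monomial m r =>
    have hpow : ∀ m : ℕ, a ^ m * b = c ^ m • b := fun m => by
      induction m with
      | zero => simp
      | succ m ih => rw [pow_succ, mul_assoc, h, mul_smul_comm, ih, smul_smul, pow_succ']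
    rw [Polynomial.aeval_monomial, Polynomial.eval_monomial, mul_assoc, hpow,
      Algebra.algebraMap_eq_smul_one, smul_mul_assoc, one_mul, smul_smul]

variable {n : Type*} [Fintype n] [DecidableEq n]

theorem cfc_mul_of_mul_eq_smul {A B : Matrix n n ℂ} (hA : A.IsHermitian) {c : ℝ}
    (h : A * B = c • B) (f : ℝ → ℝ) : cfc f A * B = f c • B := by
  classical
  -- interpolating `f` on the finite spectrum and at `c` makes `cfc f A` a polynomial in `A`
  let s : Finset ℝ := insert c A.finite_real_spectrum.toFinset
  let p : Polynomial ℝ := Lagrange.interpolate s id f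
  have hp : ∀ x ∈ s, p.eval x = f x := fun x hx =>
    Lagrange.eval_interpolate_at_node f Function.injective_id.injOn hx
  have hcfc : cfc f A = Polynomial.aeval A p := by
    rw [← cfc_polynomial p A hA.isSelfAdjoint]
    exact cfc_congr fun x hx => (hp x (Finset.mem_insert_of_mem
      (A.finite_real_spectrum.mem_toFinset.mpr hx))).symm
  rw [hcfc, aeval_mul_of_mul_eq_smul h, hp c (Finset.mem_insert_self _ _)]

variable {σ : Matrix n n ℂ} (hσ : σ.IsHermitian)

/-- The rank-one projections onto the vectors of the eigenbasis of a Hermitian matrix. -/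
def eigenProj (i : n) : Matrix n n ℂ :=
  Matrix.vecMulVec (hσ.eigenvectorBasis i) (star (hσ.eigenvectorBasis i : n → ℂ))

theorem posSemidef_eigenProj (i : n) : (eigenProj hσ i).PosSemidef :=
  Matrix.posSemidef_vecMulVec_self_star _

theorem trace_eigenProj (i : n) : (eigenProj hσ i).trace = 1 := by
  rw [eigenProj, trace_vecMulVec_star, ← EuclideanSpace.norm_sq_eq,
    hσ.eigenvectorBasis.norm_eq_one]
  simp

theorem sum_eigenProj : ∑ i, eigenProj hσ i = 1 := by
  rw [← Unitary.coe_mul_star_self hσ.eigenvectorUnitary]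
  ext x y
  simp [eigenProj, Matrix.sum_apply, Matrix.mul_apply, Matrix.vecMulVec_apply]

theorem mul_eigenProj (i : n) : σ * eigenProj hσ i = hσ.eigenvalues i • eigenProj hσ i := by
  rw [eigenProj, Matrix.mul_vecMulVec, hσ.mulVec_eigenvectorBasis, Matrix.smul_vecMulVec]

theorem cfc_eq_sum_eigenProj (f : ℝ → ℝ) :
    cfc f σ = ∑ i, f (hσ.eigenvalues i) • eigenProj hσ i := by
  rw [← mul_one (cfc f σ), ← sum_eigenProj hσ, Finset.mul_sum]
  exact Finset.sum_congr rfl fun i _ => cfc_mul_of_mul_eq_smul hσ (mul_eigenProj hσ i) f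

theorem eq_sum_eigenProj : σ = ∑ i, hσ.eigenvalues i • eigenProj hσ i := by
  conv_lhs => rw [← mul_one σ, ← sum_eigenProj hσ, Finset.mul_sum]
  simp only [mul_eigenProj]

/-- The probability `tr (ρ Pᵢ)` of the `i`-th outcome when the eigenbasis of `σ` is measured in the
state `ρ`. -/
def spectralWeight (ρ : Matrix n n ℂ) (i : n) : ℝ :=
  (ρ * eigenProj hσ i).trace.re

theorem spectralWeight_nonneg {ρ : Matrix n n ℂ} (hρ : ρ.PosSemidef) (i : n) :
    0 ≤ spectralWeight hσ ρ i :=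
  re_trace_mul_nonneg hρ (posSemidef_eigenProj hσ i)

theorem sum_spectralWeight (ρ : Matrix n n ℂ) : ∑ i, spectralWeight hσ ρ i = ρ.trace.re := by
  simp only [spectralWeight, ← Complex.re_sum, ← Matrix.trace_sum, ← Matrix.mul_sum,
    sum_eigenProj, mul_one]

theorem spectralWeight_eq_zero {ρ : Matrix n n ℂ} (hker : ∀ v : n → ℂ, σ *ᵥ v = 0 → ρ *ᵥ v = 0)
    {i : n} (hi : hσ.eigenvalues i = 0) : spectralWeight hσ ρ i = 0 := by
  have hv : σ *ᵥ hσ.eigenvectorBasis i = 0 := by rw [hσ.mulVec_eigenvectorBasis, hi, zero_smul]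
  simp [spectralWeight, eigenProj, Matrix.mul_vecMulVec, hker _ hv]

theorem re_trace_mul_cfc (ρ : Matrix n n ℂ) (f : ℝ → ℝ) :
    (ρ * cfc f σ).trace.re = ∑ i, spectralWeight hσ ρ i * f (hσ.eigenvalues i) := by
  simp [cfc_eq_sum_eigenProj hσ, Matrix.mul_sum, Matrix.trace_sum, spectralWeight, mul_comm]

theorem re_trace_mul_eq_sum (ρ : Matrix n n ℂ) :
    (ρ * σ).trace.re = ∑ i, spectralWeight hσ ρ i * hσ.eigenvalues i := by
  conv_lhs => rw [eq_sum_eigenProj hσ]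
  simp [Matrix.mul_sum, Matrix.trace_sum, spectralWeight, mul_comm]

end FunctionalCalculus

section States

variable {n : Type} [Fintype n] {ρ σ : Matrix n n ℂ}

theorem isState_vecMulVec_star {v : n → ℂ} (hv : ∑ j, ‖v j‖ ^ 2 = 1) :
    IsState (Matrix.vecMulVec v (star v)) :=
  ⟨Matrix.posSemidef_vecMulVec_self_star v, by rw [trace_vecMulVec_star, hv, Complex.ofReal_one]⟩

theorem isState_kronecker {m : Type} [Fintype m] {τ : Matrix m m ℂ} (hσ : IsState σ)
    (hτ : IsState τ) : IsState (Matrix.kroneckerMap (· * ·) σ τ) :=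
  ⟨hσ.1.kronecker hτ.1, by
    rw [Matrix.trace_kronecker (A := σ) (B := τ), hσ.2, hτ.2, one_mul]⟩

theorem convex_setOf_isState : Convex ℝ {ρ : Matrix n n ℂ | IsState ρ} := by
  rintro ρ ⟨hρ, hρ1⟩ σ ⟨hσ, hσ1⟩ a b ha hb hab
  refine ⟨(posSemidef_smul_of_nonneg hρ ha).add (posSemidef_smul_of_nonneg hσ hb), ?_⟩
  rw [Matrix.trace_add, Matrix.trace_smul, Matrix.trace_smul, hρ1, hσ1, ← add_smul, hab, one_smul]

theorem re_trace_mul_le_one (hρ : IsState ρ) (hσ : IsState σ) : (ρ * σ).trace.re ≤ 1 := by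
  classical
  obtain ⟨hρ, hρ1⟩ := hρ
  obtain ⟨hσ, hσ1⟩ := hσ
  have hsum : ∑ i, hσ.isHermitian.eigenvalues i = 1 := by
    have htr := hσ.isHermitian.trace_eq_sum_eigenvalues
    rw [hσ1] at htr
    exact Complex.ofReal_injective (by simpa using htr.symm)
  have hle : ∀ i, hσ.isHermitian.eigenvalues i ≤ 1 := fun i => hsum ▸
    Finset.single_le_sum (fun j _ => hσ.eigenvalues_nonneg j) (Finset.mem_univ i)
  calc (ρ * σ).trace.re = ∑ i, spectralWeight hσ.isHermitian ρ i * hσ.isHermitian.eigenvalues i :=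
        re_trace_mul_eq_sum hσ.isHermitian ρ
    _ ≤ ∑ i, spectralWeight hσ.isHermitian ρ i := Finset.sum_le_sum fun i _ =>
        mul_le_of_le_one_right (spectralWeight_nonneg _ hρ i) (hle i)
    _ = 1 := by rw [sum_spectralWeight, hρ1, Complex.one_re]

/- Jensen's inequality for the logarithm, applied to the distribution of the eigenvalues of `σ` in
the state `ρ`. -/
theorem re_trace_mul_cfc_logb_le [DecidableEq n] (hρ : IsState ρ) (hσ : σ.PosSemidef)
    (hker : ∀ v : n → ℂ, σ *ᵥ v = 0 → ρ *ᵥ v = 0) {c : ℝ} (hc : 0 < c)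
    (h : (ρ * σ).trace.re ≤ c) : (ρ * cfc (Real.logb 2) σ).trace.re ≤ Real.logb 2 c := by
  set p := spectralWeight hσ.isHermitian ρ
  set r := hσ.isHermitian.eigenvalues
  have hp1 : ∑ i, p i = 1 := by rw [sum_spectralWeight, hρ.2, Complex.one_re]
  have hterm : ∀ i, p i * Real.log (r i) ≤ p i * (r i / c - 1 + Real.log c) := fun i => by
    rcases (hσ.eigenvalues_nonneg i).eq_or_lt with h0 | h0
    · rw [show p i = 0 from spectralWeight_eq_zero _ hker h0.symm, zero_mul, zero_mul]
    · refine mul_le_mul_of_nonneg_left ?_ (spectralWeight_nonneg _ hρ.1 i)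
      have := Real.log_le_sub_one_of_pos (div_pos h0 hc)
      rw [Real.log_div h0.ne' hc.ne'] at this
      linarith
  rw [re_trace_mul_eq_sum hσ.isHermitian] at h
  rw [re_trace_mul_cfc hσ.isHermitian]
  simp only [Real.logb, mul_div_assoc', ← Finset.sum_div]
  gcongr
  calc ∑ i, p i * Real.log (r i) ≤ ∑ i, p i * (r i / c - 1 + Real.log c) :=
        Finset.sum_le_sum fun i _ => hterm i
    _ = (∑ i, p i * r i) / c - ∑ i, p i + (∑ i, p i) * Real.log c := by
        rw [Finset.sum_div, Finset.sum_mul, ← Finset.sum_sub_distrib, ← Finset.sum_add_distrib]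
        exact Finset.sum_congr rfl fun i _ => by ring
    _ ≤ Real.log c := by
        rw [hp1]
        linarith [(div_le_one hc).mpr h]

end States

section ProductStates

variable {P : Type} [Fintype P] {ι : P → Type}

/-- The product vector `⨂_{l} a l`. -/
def prodVec (a : ∀ l, ι l → ℂ) : (∀ l, ι l) → ℂ :=
  fun x => ∏ l, a l (x l)

theorem prodVec_smul (r : P → ℂ) (a : ∀ l, ι l → ℂ) :
    prodVec (fun l => r l • a l) = (∏ l, r l) • prodVec a := by
  ext x
  simp [prodVec, Finset.prod_mul_distrib]

theorem productOp_vecMulVec_star (a : ∀ l, ι l → ℂ) :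
    productOp (fun l => Matrix.vecMulVec (a l) (star (a l))) =
      Matrix.vecMulVec (prodVec a) (star (prodVec a)) := by
  ext x y
  simp [productOp, prodVec, Matrix.vecMulVec_apply, Finset.prod_mul_distrib]

theorem prodVec_single [DecidableEq (∀ l, ι l)] [∀ l, DecidableEq (ι l)] (x : ∀ l, ι l) :
    prodVec (fun l => Pi.single (x l) 1) = Pi.single x 1 := by
  ext y
  simp only [prodVec, Pi.single_apply, Fintype.prod_ite_zero, Finset.prod_const_one, funext_iff]

theorem productOp_sum [DecidableEq P] {κ : P → Type} [∀ l, Fintype (κ l)]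
    (A : ∀ l, κ l → Matrix (ι l) (ι l) ℂ) :
    productOp (fun l => ∑ i, A l i) = ∑ i : ∀ l, κ l, productOp fun l => A l (i l) := by
  ext x y
  simp only [productOp, Matrix.sum_apply]
  exact Fintype.prod_sum fun l i => A l i (x l) (y l)

theorem posSemidef_productOp [∀ l, Finite (ι l)] {A : ∀ l, Matrix (ι l) (ι l) ℂ}
    (hA : ∀ l, (A l).PosSemidef) : (productOp A).PosSemidef := by
  classical
  have := fun l => Fintype.ofFinite (ι l)
  choose m w hw using fun l => Matrix.posSemidef_iff_eq_sum_vecMulVec.mp (hA l)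
  rw [funext hw, productOp_sum]
  refine Matrix.posSemidef_sum _ fun i _ => ?_
  rw [productOp_vecMulVec_star]
  exact Matrix.posSemidef_vecMulVec_self_star _

theorem vecMulVec_prodVec_mem_SEP [∀ l, Fintype (ι l)] {a : ∀ l, ι l → ℂ}
    (ha : ∀ l, ∑ j, ‖a l j‖ ^ 2 = 1) :
    Matrix.vecMulVec (prodVec a) (star (prodVec a)) ∈ SEP ι :=
  subset_convexHull ℝ _ ⟨_, fun l => isState_vecMulVec_star (ha l),
    (productOp_vecMulVec_star a).symm⟩

variable [DecidableEq P] [∀ l, Fintype (ι l)]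

theorem trace_productOp (A : ∀ l, Matrix (ι l) (ι l) ℂ) :
    (productOp A).trace = ∏ l, (A l).trace :=
  (Fintype.prod_sum fun l i => A l i i).symm

theorem isState_productOp {A : ∀ l, Matrix (ι l) (ι l) ℂ} (hA : ∀ l, IsState (A l)) :
    IsState (productOp A) :=
  ⟨posSemidef_productOp fun l => (hA l).1, by simp [trace_productOp, (hA _).2]⟩

theorem isState_of_mem_SEP {σ : Op ι} (hσ : σ ∈ SEP ι) : IsState σ := by
  refine convexHull_min ?_ convex_setOf_isState hσ
  rintro _ ⟨A, hA, rfl⟩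
  exact isState_productOp hA

end ProductStates

section ProductBound

variable {P : Type} [Fintype P] [DecidableEq P] {ι : P → Type} [∀ l, Fintype (ι l)]

/-- `⟨a|ρ|a⟩ ≤ c ⟨a|a⟩` for all product vectors `a`; for a state this says `Λ²(ρ) ≤ c`. -/
def ProductBound (ρ : Op ι) (c : ℝ) : Prop :=
  ∀ a : ∀ l, ι l → ℂ, (star (prodVec a) ⬝ᵥ ρ *ᵥ prodVec a).re ≤ c * ∏ l, ∑ j, ‖a l j‖ ^ 2

theorem productBound_vecMulVec_star_iff {ψ : (∀ l, ι l) → ℂ} {c : ℝ} :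
    ProductBound (ι := ι) (Matrix.vecMulVec ψ (star ψ)) c ↔
      ∀ a : ∀ l, ι l → ℂ, ‖star ψ ⬝ᵥ prodVec a‖ ^ 2 ≤ c * ∏ l, ∑ j, ‖a l j‖ ^ 2 := by
  simp only [ProductBound, re_dotProduct_vecMulVec_star_mulVec]

theorem productBound_of_forall_unit {ρ : Op ι} {c : ℝ}
    (h : ∀ a : ∀ l, ι l → ℂ, (∀ l, ∑ j, ‖a l j‖ ^ 2 = 1) →
      (star (prodVec a) ⬝ᵥ ρ *ᵥ prodVec a).re ≤ c) : ProductBound ρ c := by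
  intro a
  by_cases h0 : ∃ l, ∑ j, ‖a l j‖ ^ 2 = 0
  · obtain ⟨l, hl⟩ := h0
    have hal : ∀ j, a l j = 0 := by
      simpa [Finset.sum_eq_zero_iff_of_nonneg, sq_nonneg] using hl
    have hprod : prodVec a = 0 := funext fun x => Finset.prod_eq_zero (Finset.mem_univ l) (hal _)
    rw [Finset.prod_eq_zero (f := fun l => ∑ j, ‖a l j‖ ^ 2) (Finset.mem_univ l) hl]
    simp [hprod]
  · push Not at h0
    choose u hu1 hu using fun l => exists_eq_smul_unit (h0 l)
    set r : P → ℝ := fun l => √(∑ j, ‖a l j‖ ^ 2)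
    calc (star (prodVec a) ⬝ᵥ ρ *ᵥ prodVec a).re
        = (∏ l, r l) ^ 2 * (star (prodVec u) ⬝ᵥ ρ *ᵥ prodVec u).re := by
          rw [funext hu, prodVec_smul, ← Complex.ofReal_prod, re_dotProduct_mulVec_smul,
            Complex.norm_real, Real.norm_eq_abs, sq_abs]
      _ ≤ (∏ l, r l) ^ 2 * c := by gcongr; exact h u hu1
      _ = c * ∏ l, ∑ j, ‖a l j‖ ^ 2 := by
          rw [mul_comm, ← Finset.prod_pow]
          simp only [r, Real.sq_sqrt (sum_norm_sq_nonneg _)]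

theorem productBound_iff_forall_mem_SEP {ρ : Op ι} {c : ℝ} :
    ProductBound ρ c ↔ ∀ σ ∈ SEP ι, (ρ * σ).trace.re ≤ c := by
  refine ⟨fun h σ hσ => ?_, fun h => productBound_of_forall_unit fun a ha => ?_⟩
  · have hconvex : Convex ℝ {σ : Op ι | (ρ * σ).trace.re ≤ c} :=
      convex_halfSpace_le ⟨fun σ τ => by simp [mul_add], fun r σ => by simp⟩ c
    refine convexHull_min ?_ hconvex hσ
    rintro _ ⟨A, hA, rfl⟩
    choose m w hw using fun l => Matrix.posSemidef_iff_eq_sum_vecMulVec.mp (hA l).1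
    have hnorm : ∀ l, ∑ i, ∑ j, ‖w l i j‖ ^ 2 = 1 := fun l => by
      have htr := (hA l).2
      simp only [hw l, Matrix.trace_sum, trace_vecMulVec_star] at htr
      exact_mod_cast htr
    calc (ρ * productOp A).trace.re
        = ∑ i : ∀ l, Fin (m l), (star (prodVec fun l => w l (i l)) ⬝ᵥ
            ρ *ᵥ prodVec fun l => w l (i l)).re := by
          rw [funext hw, productOp_sum, Matrix.mul_sum, Matrix.trace_sum, Complex.re_sum]
          simp only [productOp_vecMulVec_star, trace_mul_vecMulVec_star]
      _ ≤ ∑ i : ∀ l, Fin (m l), c * ∏ l, ∑ j, ‖w l (i l) j‖ ^ 2 :=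
          Finset.sum_le_sum fun i _ => h _
      _ = c := by
          rw [← Finset.mul_sum, ← Fintype.prod_sum fun l i => ∑ j, ‖w l i j‖ ^ 2]
          simp [hnorm]
  · rw [← trace_mul_vecMulVec_star]
    exact h _ (vecMulVec_prodVec_mem_SEP ha)

theorem ProductBound.re_trace_le {ρ : Op ι} {c : ℝ} (h : ProductBound ρ c) :
    ρ.trace.re ≤ Fintype.card (∀ l, ι l) * c := by
  classical
  have hdiag : ∀ x, (ρ x x).re ≤ c := fun x => by
    have hx := h fun l => Pi.single (x l) 1
    simpa [prodVec_single, Pi.single_apply, apply_ite norm] using hx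
  calc ρ.trace.re = ∑ x, (ρ x x).re := by rw [Matrix.trace, Complex.re_sum]; rfl
    _ ≤ ∑ _x : ∀ l, ι l, c := Finset.sum_le_sum fun x _ => hdiag x
    _ = _ := by simp

theorem ProductBound.pos {ρ : Op ι} {c : ℝ} (h : ProductBound ρ c) (hρ : ρ.trace = 1) : 0 < c := by
  have h1 := h.re_trace_le
  rw [hρ, Complex.one_re] at h1
  exact pos_of_mul_pos_right (one_pos.trans_le h1) (Nat.cast_nonneg _)

theorem ProductBound.submatrix {κ : P → Type} [∀ l, Fintype (κ l)] {ρ : Op κ} {c : ℝ}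
    (h : ProductBound ρ c) (e : ∀ l, ι l ≃ κ l) :
    ProductBound (ι := ι) (ρ.submatrix (Equiv.piCongrRight e) (Equiv.piCongrRight e)) c := by
  intro a
  have hform := h fun l j => a l ((e l).symm j)
  have hprod : prodVec (fun l j => a l ((e l).symm j)) =
      prodVec a ∘ (Equiv.piCongrRight e).symm := rfl
  have hnorm : ∀ l, ∑ j, ‖a l ((e l).symm j)‖ ^ 2 = ∑ j, ‖a l j‖ ^ 2 := fun l =>
    (e l).symm.sum_comp fun j => ‖a l j‖ ^ 2
  simp only [hprod, hnorm] at hform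
  rwa [Matrix.submatrix_mulVec_equiv, ← comp_equiv_symm_dotProduct]

end ProductBound

section Tensor

variable {P : Type} [Fintype P] {ι κ : P → Type} [∀ l, Fintype (ι l)] [∀ l, Fintype (κ l)]

theorem tensor_mem_SEP {σ : Op ι} {τ : Op κ} (hσ : σ ∈ SEP ι) (hτ : τ ∈ SEP κ) :
    tensor σ τ ∈ SEP (fun l => ι l × κ l) := by
  obtain ⟨Θ, _, w, z, hw, hw1, hz, rfl⟩ := mem_convexHull_iff_exists_fintype.mp hσ
  obtain ⟨Φ, _, v, y, hv, hv1, hy, rfl⟩ := mem_convexHull_iff_exists_fintype.mp hτ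
  choose A hA hzA using hz
  choose B hB hyB using hy
  refine mem_convexHull_iff_exists_fintype.mpr ⟨Θ × Φ, inferInstance, fun i => w i.1 * v i.2,
    fun i => productOp fun l => Matrix.kroneckerMap (· * ·) (A i.1 l) (B i.2 l),
    fun i => mul_nonneg (hw _) (hv _), ?_,
    fun i => ⟨_, fun l => isState_kronecker (hA _ _) (hB _ _), rfl⟩, ?_⟩
  · rw [Fintype.sum_prod_type, ← Finset.sum_mul_sum, hw1, hv1, one_mul]
  · ext x x'
    simp only [tensor, Matrix.sum_apply, Matrix.smul_apply, hzA, hyB, Finset.sum_mul_sum,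
      Fintype.sum_prod_type]
    refine Finset.sum_congr rfl fun i _ => Finset.sum_congr rfl fun j _ => ?_
    simp only [productOp, Matrix.kroneckerMap_apply, Finset.prod_mul_distrib, Complex.real_smul,
      Complex.ofReal_mul]
    ring

variable [DecidableEq P]

theorem sum_arrow_prod {R : Type*} [AddCommMonoid R] (f : (∀ l, ι l) → (∀ l, κ l) → R) :
    ∑ z : ∀ l, ι l × κ l, f (fun l => (z l).1) (fun l => (z l).2) = ∑ x, ∑ y, f x y := by
  rw [← Fintype.sum_prod_type']
  exact (Equiv.arrowProdEquivProdArrow P ι κ).sum_comp fun z => f z.1 z.2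

theorem trace_tensor (ρ : Op ι) (σ : Op κ) : (tensor ρ σ).trace = ρ.trace * σ.trace := by
  simp only [Matrix.trace, Finset.sum_mul_sum]
  exact sum_arrow_prod fun x y => ρ x x * σ y y

theorem tensor_mul_tensor (ρ σ : Op ι) (ρ' σ' : Op κ) :
    tensor ρ ρ' * tensor σ σ' = tensor (ρ * σ) (ρ' * σ') := by
  ext x y
  simp only [tensor, Matrix.mul_apply, Finset.sum_mul_sum, mul_mul_mul_comm (ρ _ _)]
  exact sum_arrow_prod fun z w => ρ _ z * σ z _ * (ρ' _ w * σ' w _)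

theorem dotProduct_tensor_mulVec_prodVec (ρ : Op ι) (σ : Op κ) (a : ∀ l, ι l × κ l → ℂ) :
    star (prodVec a) ⬝ᵥ tensor ρ σ *ᵥ prodVec a =
      ∑ x, ∑ y, ρ x y * (star (prodVec fun l j => a l (x l, j)) ⬝ᵥ
        σ *ᵥ prodVec fun l j => a l (y l, j)) := by
  let b : (∀ l, ι l) → (∀ l, κ l) → ℂ := fun x => prodVec fun l j => a l (x l, j)
  calc star (prodVec a) ⬝ᵥ tensor ρ σ *ᵥ prodVec a
      = ∑ x, ∑ z, star (b x z) * ∑ y, ∑ w, ρ x y * σ z w * b y w := by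
        simp only [dotProduct, Matrix.mulVec]
        rw [← sum_arrow_prod]
        simp only [← sum_arrow_prod]
        rfl
    _ = ∑ x, ∑ y, ρ x y * (star (b x) ⬝ᵥ σ *ᵥ b y) := by
        simp only [dotProduct, Matrix.mulVec, Finset.mul_sum, Pi.star_apply]
        refine Finset.sum_congr rfl fun x _ => Finset.sum_comm.trans ?_
        refine Finset.sum_congr rfl fun y _ => Finset.sum_congr rfl fun z _ =>
          Finset.sum_congr rfl fun w _ => by ring

theorem ProductBound.norm_dotProduct_mulVec_le {σ : Op κ} {s : ℝ} (h : ProductBound σ s)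
    (hσ : σ.PosSemidef) (hs : 0 ≤ s) (a b : ∀ l, κ l → ℂ) :
    ‖star (prodVec a) ⬝ᵥ σ *ᵥ prodVec b‖ ≤
      s * ((∏ l, √(∑ j, ‖a l j‖ ^ 2)) * ∏ l, √(∑ j, ‖b l j‖ ^ 2)) := by
  refine le_of_sq_le_sq ?_ (by positivity)
  calc ‖star (prodVec a) ⬝ᵥ σ *ᵥ prodVec b‖ ^ 2
      ≤ (star (prodVec a) ⬝ᵥ σ *ᵥ prodVec a).re * (star (prodVec b) ⬝ᵥ σ *ᵥ prodVec b).re :=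
        norm_dotProduct_mulVec_sq_le hσ _ _
    _ ≤ (s * ∏ l, ∑ j, ‖a l j‖ ^ 2) * (s * ∏ l, ∑ j, ‖b l j‖ ^ 2) :=
        mul_le_mul (h a) (h b) (re_dotProduct_mulVec_nonneg hσ _)
          (mul_nonneg hs (Finset.prod_nonneg fun l _ => sum_norm_sq_nonneg _))
    _ = _ := by
        rw [mul_pow, mul_pow, ← Finset.prod_pow, ← Finset.prod_pow]
        simp only [Real.sq_sqrt (sum_norm_sq_nonneg _)]
        ring

/- Because the entries of `ρ` are non-negative, the vectors `a l (i, ·)` may be replaced by their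
norms `t l i`, which turns the overlap with `ρ ⊗ σ` into one with `ρ` alone. -/
theorem ProductBound.tensor {ρ : Op ι} {σ : Op κ} {c s : ℝ} (hρ : ProductBound ρ c)
    (hnn : ∀ x y, 0 ≤ ρ x y) (hσ : ProductBound σ s) (hpos : σ.PosSemidef) (hs : 0 ≤ s) :
    ProductBound (tensor ρ σ) (c * s) := by
  intro a
  let t : ∀ l, ι l → ℝ := fun l i => √(∑ j, ‖a l (i, j)‖ ^ 2)
  have hform : (star (prodVec fun l i => (t l i : ℂ)) ⬝ᵥ ρ *ᵥ prodVec fun l i => (t l i : ℂ)).re =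
      ∑ x, ∑ y, ‖ρ x y‖ * ((∏ l, t l (x l)) * ∏ l, t l (y l)) := by
    simp only [dotProduct, Matrix.mulVec, Pi.star_apply, Finset.mul_sum, Complex.re_sum, prodVec]
    refine Finset.sum_congr rfl fun x _ => Finset.sum_congr rfl fun y _ => ?_
    rw [← Complex.norm_of_nonneg' (hnn x y), ← Complex.ofReal_prod, ← Complex.ofReal_prod,
      Complex.star_def, Complex.conj_ofReal, ← Complex.ofReal_mul, ← Complex.ofReal_mul,
      Complex.ofReal_re, Complex.norm_real, norm_norm]
    ring
  have hnorm : ∀ l, ∑ i, ‖(t l i : ℂ)‖ ^ 2 = ∑ z, ‖a l z‖ ^ 2 := fun l => by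
    simp only [Complex.norm_real, Real.norm_eq_abs, sq_abs, t, Fintype.sum_prod_type,
      Real.sq_sqrt (sum_norm_sq_nonneg _)]
  calc _ ≤ ∑ x, ∑ y, ‖ρ x y‖ * (s * ((∏ l, t l (x l)) * ∏ l, t l (y l))) := by
        rw [dotProduct_tensor_mulVec_prodVec]
        refine (Complex.re_le_norm _).trans (norm_sum_le_of_le _ fun x _ =>
          norm_sum_le_of_le _ fun y _ => (norm_mul_le _ _).trans ?_)
        gcongr
        exact hσ.norm_dotProduct_mulVec_le hpos hs _ _
    _ = s * (star (prodVec fun l i => (t l i : ℂ)) ⬝ᵥ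
          ρ *ᵥ prodVec fun l i => (t l i : ℂ)).re := by
        simp only [hform, Finset.mul_sum, mul_left_comm]
    _ ≤ s * (c * ∏ l, ∑ i, ‖(t l i : ℂ)‖ ^ 2) := mul_le_mul_of_nonneg_left (hρ _) hs
    _ = c * s * ∏ l, ∑ z, ‖a l z‖ ^ 2 := by
        simp only [hnorm]
        ring

end Tensor

section Copies

variable {P : Type} {ι : P → Type}

theorem copies_smul (r : ℝ) (ρ : Op ι) (n : ℕ) : copies (r • ρ) n = r ^ n • copies ρ n := by
  ext x y
  simp [copies, Finset.prod_mul_distrib]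

theorem copies_eq_submatrix_productOp (ρ : Op ι) (n : ℕ) :
    copies ρ n = (productOp fun _ : Fin n => ρ).submatrix
      (Equiv.piComm fun l (_ : Fin n) => ι l) (Equiv.piComm fun l (_ : Fin n) => ι l) := rfl

theorem copies_succ (ρ : Op ι) (n : ℕ) :
    copies ρ (n + 1) = (tensor ρ (copies ρ n)).submatrix
      (Equiv.piCongrRight fun l => (Fin.consEquiv fun _ => ι l).symm)
      (Equiv.piCongrRight fun l => (Fin.consEquiv fun _ => ι l).symm) := by
  ext x y
  exact Fin.prod_univ_succ _

variable [Fintype P] [∀ l, Fintype (ι l)]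

theorem copies_mem_SEP {σ : Op ι} (hσ : σ ∈ SEP ι) (n : ℕ) :
    copies σ n ∈ SEP (fun l => Fin n → ι l) := by
  obtain ⟨Θ, _, w, z, hw, hw1, hz, rfl⟩ := mem_convexHull_iff_exists_fintype.mp hσ
  choose A hA hzA using hz
  refine mem_convexHull_iff_exists_fintype.mpr ⟨Fin n → Θ, inferInstance, fun i => ∏ m, w (i m),
    fun i => productOp fun l => productOp fun m => A (i m) l,
    fun i => Finset.prod_nonneg fun _ _ => hw _, ?_,
    fun i => ⟨_, fun l => isState_productOp fun m => hA _ _, rfl⟩, ?_⟩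
  · rw [← Fintype.sum_pow, hw1, one_pow]
  · ext x y
    simp only [copies, Matrix.sum_apply, Matrix.smul_apply, hzA, Fintype.prod_sum]
    refine Finset.sum_congr rfl fun i _ => ?_
    simp only [productOp, Complex.real_smul, Finset.prod_mul_distrib, Complex.ofReal_prod]
    rw [Finset.prod_comm]

variable [DecidableEq P]

theorem sum_prod_copies {R : Type*} [CommSemiring R] {n : ℕ} (f : Fin n → (∀ l, ι l) → R) :
    ∑ x : ∀ l, Fin n → ι l, ∏ m, f m (fun l => x l m) = ∏ m, ∑ x, f m x := by
  rw [Fintype.prod_sum]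
  exact (Equiv.piComm fun l (_ : Fin n) => ι l).sum_comp fun x => ∏ m, f m (x m)

theorem copies_mul_copies (ρ σ : Op ι) (n : ℕ) :
    copies ρ n * copies σ n = copies (ρ * σ) n := by
  ext x y
  simp only [copies, Matrix.mul_apply, ← Finset.prod_mul_distrib]
  exact sum_prod_copies fun m z => ρ (fun l => x l m) z * σ z (fun l => y l m)

theorem trace_copies (ρ : Op ι) (n : ℕ) : (copies ρ n).trace = ρ.trace ^ n := by
  simp only [Matrix.trace, Matrix.diag_apply, copies]
  rw [sum_prod_copies fun _ x => ρ x x, Fin.prod_const]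

theorem isState_copies {ρ : Op ι} (hρ : IsState ρ) (n : ℕ) : IsState (copies ρ n) := by
  refine ⟨?_, by rw [trace_copies, hρ.2, one_pow]⟩
  rw [copies_eq_submatrix_productOp]
  exact (posSemidef_productOp fun _ => hρ.1).submatrix _

theorem ProductBound.copies {ρ : Op ι} {c : ℝ} (hρ : ProductBound ρ c) (hs : IsState ρ)
    (hnn : ∀ x y, 0 ≤ ρ x y) (n : ℕ) : ProductBound (copies ρ n) (c ^ n) := by
  induction n with
  | zero =>
    rw [pow_zero, productBound_iff_forall_mem_SEP]
    exact fun σ hσ => re_trace_mul_le_one (isState_copies hs 0) (isState_of_mem_SEP hσ)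
  | succ n ih =>
    rw [copies_succ, pow_succ']
    exact (hρ.tensor hnn ih (isState_copies hs n).1
      (pow_nonneg (hρ.pos hs.2).le n)).submatrix _

end Copies

section GeometricMeasure

variable {P : Type} [Fintype P] [DecidableEq P] {ι κ : P → Type}
variable [∀ l, Fintype (ι l)] [∀ l, Fintype (κ l)]

/-- The overlaps `tr (ρσ)` of `ρ` with the fully separable states, whose supremum is `Λ²(ρ)`. -/
def separableOverlaps (ρ : Op ι) : Set ℝ :=
  {r | ∃ σ ∈ SEP ι, r = (ρ * σ).trace.re}

theorem mem_upperBounds_separableOverlaps {ρ : Op ι} {c : ℝ} :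
    c ∈ upperBounds (separableOverlaps ρ) ↔ ProductBound ρ c := by
  rw [productBound_iff_forall_mem_SEP]
  exact ⟨fun h σ hσ => h ⟨σ, hσ, rfl⟩, by rintro h _ ⟨σ, hσ, rfl⟩; exact h σ hσ⟩

theorem nonneg_of_mem_separableOverlaps {ρ : Op ι} (hρ : ρ.PosSemidef) {r : ℝ}
    (hr : r ∈ separableOverlaps ρ) : 0 ≤ r := by
  obtain ⟨σ, hσ, rfl⟩ := hr
  exact re_trace_mul_nonneg hρ (isState_of_mem_SEP hσ).1

theorem pos_of_isLUB_separableOverlaps {ρ : Op ι} {s : ℝ} (hρ : IsState ρ)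
    (hs : IsLUB (separableOverlaps ρ) s) : 0 < s :=
  (mem_upperBounds_separableOverlaps.mp hs.1).pos hρ.2

theorem exists_isLUB_separableOverlaps {ρ : Op ι} (hρ : IsState ρ) :
    ∃ s, IsLUB (separableOverlaps ρ) s := by
  classical
  refine Real.exists_isLUB ?_ ⟨1, ?_⟩
  · have hne : Nonempty (∀ l, ι l) := by
      by_contra h
      rw [not_nonempty_iff] at h
      exact zero_ne_one (Matrix.trace_eq_zero_of_isEmpty ρ ▸ hρ.2)
    obtain ⟨x⟩ := hne
    exact ⟨_, _, vecMulVec_prodVec_mem_SEP (a := fun l => Pi.single (x l) 1)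
      (by simp [Pi.single_apply, apply_ite norm]), rfl⟩
  · rintro _ ⟨σ, hσ, rfl⟩
    exact re_trace_mul_le_one hρ (isState_of_mem_SEP hσ)

theorem isLUB_separableOverlaps_tensor {ρ : Op ι} {τ : Op κ} {c s : ℝ} (hρ : IsState ρ)
    (hnn : ∀ x y, 0 ≤ ρ x y) (hτ : IsState τ) (hc : IsLUB (separableOverlaps ρ) c)
    (hs : IsLUB (separableOverlaps τ) s) : IsLUB (separableOverlaps (tensor ρ τ)) (c * s) := by
  have hs0 := (pos_of_isLUB_separableOverlaps hτ hs).le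
  refine ⟨mem_upperBounds_separableOverlaps.mpr
    ((mem_upperBounds_separableOverlaps.mp hc.1).tensor hnn
      (mem_upperBounds_separableOverlaps.mp hs.1) hτ.1 hs0), fun b hb => ?_⟩
  have hmul : ∀ r ∈ separableOverlaps ρ, ∀ r' ∈ separableOverlaps τ, r * r' ≤ b := by
    rintro _ ⟨σ, hσ, rfl⟩ _ ⟨σ', hσ', rfl⟩
    refine hb ⟨_, tensor_mem_SEP hσ hσ', ?_⟩
    have him : (ρ * σ).trace.im = 0 :=
      (Complex.nonneg_iff.mp (trace_mul_nonneg hρ.1 (isState_of_mem_SEP hσ).1)).2.symm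
    rw [tensor_mul_tensor, trace_tensor, Complex.mul_re, him, zero_mul, sub_zero]
  refine (hc.mul_right hs0).2 ?_
  rintro _ ⟨r, hr, rfl⟩
  refine (hs.mul_left (nonneg_of_mem_separableOverlaps hρ.1 hr)).2 ?_
  rintro _ ⟨r', hr', rfl⟩
  exact hmul r hr r' hr'

variable [∀ l, DecidableEq (ι l)]

theorem GM_eq_of_isLUB {ρ : Op ι} {s : ℝ} (hs0 : 0 ≤ s) (hs : IsLUB (separableOverlaps ρ) s) :
    GM ι ρ = -Real.logb 2 s := by
  have hsup : sSup {r : ℝ | ∃ σ ∈ SEP ι, r = (ρ * σ).trace.re} = s := hs.csSup_eq hs.nonempty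
  rw [GM, maxOverlap, hsup, Real.logb, Real.logb, Real.log_sqrt hs0]
  ring

theorem isStrongAdditive_GM {ρ : Op ι} (hρ : IsState ρ) (hnn : ∀ x y, 0 ≤ ρ x y) :
    IsStrongAdditive GM ρ := by
  intro κ _ _ τ hτ
  obtain ⟨c, hc⟩ := exists_isLUB_separableOverlaps hρ
  obtain ⟨s, hs⟩ := exists_isLUB_separableOverlaps hτ
  have hc0 := pos_of_isLUB_separableOverlaps hρ hc
  have hs0 := pos_of_isLUB_separableOverlaps hτ hs
  rw [GM_eq_of_isLUB hc0.le hc, GM_eq_of_isLUB hs0.le hs, GM_eq_of_isLUB (mul_pos hc0 hs0).le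
    (isLUB_separableOverlaps_tensor hρ hnn hτ hc hs), Real.logb_mul hc0.ne' hs0.ne', neg_add]

end GeometricMeasure

section OverlapCertificate

variable {P : Type} [Fintype P] [DecidableEq P] {ι : P → Type} [∀ l, Fintype (ι l)]

/-- `σ` witnesses that `c` is the maximal overlap of the entrywise non-negative state `ρ` with the
separable states: no product vector exceeds `c`, and `σ` is a separable state acting as the scalar
`c` on the range of `ρ`. -/
structure OverlapCertificate (ρ σ : Op ι) (c : ℝ) : Prop where
  isState : IsState ρ
  entry_nonneg : ∀ x y, 0 ≤ ρ x y
  bound : ProductBound ρ c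
  mem_SEP : σ ∈ SEP ι
  mul_eq : σ * ρ = c • ρ

namespace OverlapCertificate

variable {ρ σ : Op ι} {c : ℝ}

theorem pos (h : OverlapCertificate ρ σ c) : 0 < c :=
  h.bound.pos h.isState.2

theorem isState_right (h : OverlapCertificate ρ σ c) : IsState σ :=
  isState_of_mem_SEP h.mem_SEP

theorem copies (h : OverlapCertificate ρ σ c) (n : ℕ) :
    OverlapCertificate (copies ρ n) (copies σ n) (c ^ n) where
  isState := isState_copies h.isState n
  entry_nonneg _ _ := Finset.prod_nonneg fun _ _ => h.entry_nonneg _ _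
  bound := h.bound.copies h.isState h.entry_nonneg n
  mem_SEP := copies_mem_SEP h.mem_SEP n
  mul_eq := by rw [copies_mul_copies, h.mul_eq, copies_smul]

theorem mul_eq_right (h : OverlapCertificate ρ σ c) : ρ * σ = c • ρ := by
  have := congrArg Matrix.conjTranspose h.mul_eq
  rwa [Matrix.conjTranspose_mul, Matrix.conjTranspose_smul, h.isState.1.isHermitian.eq,
    h.isState_right.1.isHermitian.eq, star_trivial] at this

theorem re_trace_mul (h : OverlapCertificate ρ σ c) : (ρ * σ).trace.re = c := by
  rw [h.mul_eq_right, Matrix.trace_smul, h.isState.2, Complex.smul_re, Complex.one_re, smul_eq_mul,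
    mul_one]

theorem isLUB_separableOverlaps (h : OverlapCertificate ρ σ c) : IsLUB (separableOverlaps ρ) c :=
  IsGreatest.isLUB
    ⟨⟨σ, h.mem_SEP, h.re_trace_mul.symm⟩, mem_upperBounds_separableOverlaps.mpr h.bound⟩

end OverlapCertificate

end OverlapCertificate

section Robustness

theorem exists_isState_eq_re_trace_smul {n : Type} [Fintype n] {ρ A : Matrix n n ℂ}
    (hρ : IsState ρ) (hA : A.PosSemidef) : ∃ Δ, IsState Δ ∧ A = A.trace.re • Δ := by
  have htr : A.trace = (A.trace.re : ℂ) := Complex.eq_re_of_ofReal_le hA.trace_nonneg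
  by_cases h0 : A.trace = 0
  · exact ⟨ρ, hρ, by rw [h0, Complex.zero_re, zero_smul, hA.trace_eq_zero_iff.mp h0]⟩
  · have hre : A.trace.re ≠ 0 := fun h => h0 (by rw [htr, h, Complex.ofReal_zero])
    refine ⟨A.trace.re⁻¹ • A, ⟨posSemidef_smul_of_nonneg hA
      (inv_nonneg.mpr (Complex.le_def.mp hA.trace_nonneg).1), ?_⟩, (smul_inv_smul₀ hre A).symm⟩
    rw [Matrix.trace_smul, Complex.real_smul, Complex.ofReal_inv, ← htr, inv_mul_cancel₀ h0]

variable {P : Type} [Fintype P] [DecidableEq P] {ι : P → Type}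
variable [∀ l, Fintype (ι l)] {ρ σ : Op ι} {c : ℝ}

/-- The weights `t ≥ 0` for which some state mixed into `ρ` with weight `t` makes it fully
separable; the global robustness is their infimum. -/
def separatingWeights (ρ : Op ι) : Set ℝ :=
  {t | 0 ≤ t ∧ ∃ Δ : Op ι, IsState Δ ∧ (1 + t)⁻¹ • (ρ + t • Δ) ∈ SEP ι}

theorem sub_one_mem_separatingWeights {r : ℝ} (hρ : IsState ρ) (hσ : σ ∈ SEP ι) (hr : r ≠ 0)
    (h : (r • σ - ρ).PosSemidef) : r - 1 ∈ separatingWeights ρ := by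
  have htr : (r • σ - ρ).trace.re = r - 1 := by
    rw [Matrix.trace_sub, Matrix.trace_smul, hρ.2, (isState_of_mem_SEP hσ).2]
    simp
  obtain ⟨Δ, hΔ, hsub⟩ := exists_isState_eq_re_trace_smul hρ h
  rw [htr] at hsub
  refine ⟨htr ▸ (Complex.le_def.mp h.trace_nonneg).1, Δ, hΔ, ?_⟩
  rwa [← hsub, add_sub_cancel, add_sub_cancel, inv_smul_smul₀ hr]

theorem inv_sub_one_mem_lowerBounds_separatingWeights (hρ : IsState ρ) (hpure : ρ * ρ = ρ)
    (h : ProductBound ρ c) : c⁻¹ - 1 ∈ lowerBounds (separatingWeights ρ) := by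
  rintro t ⟨ht, Δ, hΔ, hmem⟩
  have hoverlap := productBound_iff_forall_mem_SEP.mp h _ hmem
  rw [Matrix.mul_smul, mul_add, hpure, Matrix.trace_smul, Matrix.trace_add, hρ.2, Matrix.mul_smul,
    Matrix.trace_smul, Complex.smul_re, Complex.add_re, Complex.smul_re, Complex.one_re,
    smul_eq_mul, smul_eq_mul, inv_mul_le_iff₀ (by linarith)] at hoverlap
  rw [sub_le_iff_le_add, inv_le_iff_one_le_mul₀ (h.pos hρ.2)]
  linarith [mul_nonneg ht (re_trace_mul_nonneg hρ.1 hΔ.1)]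

theorem OverlapCertificate.posSemidef_inv_smul_sub (h : OverlapCertificate ρ σ c)
    (hpure : ρ * ρ = ρ) : (c⁻¹ • σ - ρ).PosSemidef := by
  classical
  have hcompress : σ - c • ρ = (1 - ρ)ᴴ * σ * (1 - ρ) := by
    rw [Matrix.conjTranspose_sub, Matrix.conjTranspose_one, h.isState.1.isHermitian.eq, sub_mul,
      mul_sub, one_mul, mul_one, h.mul_eq_right, sub_mul, h.mul_eq, Matrix.smul_mul, hpure]
    abel
  have hsub : (σ - c • ρ).PosSemidef :=
    hcompress ▸ h.isState_right.1.conjTranspose_mul_mul_same _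
  have := posSemidef_smul_of_nonneg hsub (inv_nonneg.mpr h.pos.le)
  rwa [smul_sub, inv_smul_smul₀ h.pos.ne'] at this

theorem OverlapCertificate.LGR_eq [∀ l, DecidableEq (ι l)] (h : OverlapCertificate ρ σ c)
    (hpure : ρ * ρ = ρ) : LGR ι ρ = -Real.logb 2 c := by
  have hleast : IsLeast (separatingWeights ρ) (c⁻¹ - 1) :=
    ⟨sub_one_mem_separatingWeights h.isState h.mem_SEP (inv_ne_zero h.pos.ne')
      (h.posSemidef_inv_smul_sub hpure),
      inv_sub_one_mem_lowerBounds_separatingWeights h.isState hpure h.bound⟩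
  have hrobust : globalRobustness ι ρ = c⁻¹ - 1 := hleast.csInf_eq
  rw [LGR, hrobust, add_sub_cancel, Real.logb_inv]

end Robustness

section Entropy

variable {n m : Type} [Fintype n] [Fintype m]

/-- The von Neumann entropy `-tr (ρ log₂ ρ)`, in bits. -/
def vonNeumannEntropy [DecidableEq n] (ρ : Matrix n n ℂ) : ℝ :=
  -(ρ * cfc (Real.logb 2) ρ).trace.re

/-- A decomposition `ρ = ∑ⱼ q j • T j` into eigenoperators `T j` of trace one with eigenvalue
`q j`. Terms of weight zero need not have trace one, so that the index type may contain
spare indices. -/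
structure SpectralResolution (ρ : Matrix n n ℂ) {J : Type} [Fintype J] (q : J → ℝ)
    (T : J → Matrix n n ℂ) : Prop where
  sum_eq : ρ = ∑ j, q j • T j
  trace_eq : ∀ j, q j ≠ 0 → (T j).trace = 1
  mul_eq : ∀ j, ρ * T j = q j • T j

theorem spectralResolution_eigenProj [DecidableEq n] {ρ : Matrix n n ℂ} (hρ : ρ.IsHermitian) :
    SpectralResolution ρ hρ.eigenvalues (eigenProj hρ) :=
  ⟨eq_sum_eigenProj hρ, fun i _ => trace_eigenProj hρ i, mul_eigenProj hρ⟩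

theorem spectralResolution_of_mul_self {ρ : Matrix n n ℂ} (hρ : IsState ρ) (h : ρ * ρ = ρ) :
    SpectralResolution ρ (fun _ : Unit => 1) fun _ => ρ :=
  ⟨by simp, fun _ _ => hρ.2, fun _ => by rw [h, one_smul]⟩

namespace SpectralResolution

variable {J : Type} [Fintype J] {ρ : Matrix n n ℂ} {q : J → ℝ} {T : J → Matrix n n ℂ}

theorem smul_trace (h : SpectralResolution ρ q T) (j : J) : q j • (T j).trace = q j := by
  by_cases hj : q j = 0
  · simp [hj]
  · rw [h.trace_eq j hj, Complex.real_smul, mul_one]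

theorem sum_eq_one (h : SpectralResolution ρ q T) (hρ : IsState ρ) : ∑ j, q j = 1 := by
  have htr := hρ.2
  rw [h.sum_eq, Matrix.trace_sum] at htr
  simp only [Matrix.trace_smul, h.smul_trace] at htr
  exact_mod_cast htr

theorem vonNeumannEntropy_eq [DecidableEq n] (h : SpectralResolution ρ q T) (hρ : ρ.IsHermitian) :
    vonNeumannEntropy ρ = -∑ j, q j * Real.logb 2 (q j) := by
  rw [vonNeumannEntropy, Matrix.trace_mul_comm]
  conv_lhs => enter [1, 1, 1, 2]; rw [h.sum_eq]
  rw [Matrix.mul_sum, Matrix.trace_sum, Complex.re_sum]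
  congr 1
  refine Finset.sum_congr rfl fun j _ => ?_
  rw [Matrix.mul_smul, cfc_mul_of_mul_eq_smul hρ (h.mul_eq j), smul_comm, Matrix.trace_smul,
    Matrix.trace_smul, h.smul_trace, Complex.smul_re, Complex.ofReal_re, smul_eq_mul, mul_comm]

theorem submatrix (h : SpectralResolution ρ q T) (e : m ≃ n) :
    SpectralResolution (ρ.submatrix e e) q fun j => (T j).submatrix e e where
  sum_eq := by
    conv_lhs => rw [h.sum_eq]
    ext x y
    simp [Matrix.sum_apply]
  trace_eq j hj := (e.sum_comp fun x => T j x x).trans (h.trace_eq j hj)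
  mul_eq j := by
    rw [Matrix.submatrix_mul_equiv, h.mul_eq]
    rfl

end SpectralResolution

theorem vonNeumannEntropy_of_mul_self [DecidableEq n] {ρ : Matrix n n ℂ} (hρ : IsState ρ)
    (h : ρ * ρ = ρ) : vonNeumannEntropy ρ = 0 := by
  rw [(spectralResolution_of_mul_self hρ h).vonNeumannEntropy_eq hρ.1.isHermitian]
  simp

theorem vonNeumannEntropy_submatrix [DecidableEq n] [DecidableEq m] {ρ : Matrix n n ℂ}
    (hρ : ρ.IsHermitian) (e : m ≃ n) :
    vonNeumannEntropy (ρ.submatrix e e) = vonNeumannEntropy ρ := by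
  have h := spectralResolution_eigenProj hρ
  rw [(h.submatrix e).vonNeumannEntropy_eq (hρ.submatrix e), h.vonNeumannEntropy_eq hρ]

theorem mul_mul_logb_mul (b x y : ℝ) :
    x * y * Real.logb b (x * y) = x * Real.logb b x * y + x * (y * Real.logb b y) := by
  rcases eq_or_ne x 0 with rfl | hx
  · simp
  rcases eq_or_ne y 0 with rfl | hy
  · simp
  rw [Real.logb_mul hx hy]
  ring

variable {P : Type} {ι κ : P → Type}

theorem isHermitian_tensor {ρ : Op ι} {σ : Op κ} (hρ : ρ.IsHermitian) (hσ : σ.IsHermitian) :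
    (tensor ρ σ).IsHermitian := by
  ext x y
  simp only [Matrix.conjTranspose_apply, tensor, star_mul', hρ.apply, hσ.apply]

variable [Fintype P] [DecidableEq P] [∀ l, Fintype (ι l)] [∀ l, Fintype (κ l)]

theorem SpectralResolution.tensor {J K : Type} [Fintype J] [Fintype K] {ρ : Op ι} {σ : Op κ}
    {q : J → ℝ} {p : K → ℝ} {S : J → Op ι} {T : K → Op κ} (hρ : SpectralResolution ρ q S)
    (hσ : SpectralResolution σ p T) :
    SpectralResolution (tensor ρ σ) (fun j : J × K => q j.1 * p j.2)
      fun j => MultipartiteEntanglement.tensor (S j.1) (T j.2) where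
  sum_eq := by
    conv_lhs => rw [hρ.sum_eq, hσ.sum_eq]
    ext x y
    simp only [MultipartiteEntanglement.tensor, Matrix.sum_apply, Matrix.smul_apply,
      Finset.sum_mul_sum, Fintype.sum_prod_type, smul_mul_smul_comm]
  trace_eq j hj := by
    rw [trace_tensor, hρ.trace_eq _ (left_ne_zero_of_mul hj),
      hσ.trace_eq _ (right_ne_zero_of_mul hj), one_mul]
  mul_eq j := by
    rw [tensor_mul_tensor, hρ.mul_eq, hσ.mul_eq]
    ext x y
    simp only [MultipartiteEntanglement.tensor, Matrix.smul_apply, smul_mul_smul_comm]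

variable [∀ l, DecidableEq (ι l)] [∀ l, DecidableEq (κ l)]

theorem vonNeumannEntropy_tensor {ρ : Op ι} {σ : Op κ} (hρ : IsState ρ) (hσ : IsState σ) :
    vonNeumannEntropy (tensor ρ σ) = vonNeumannEntropy ρ + vonNeumannEntropy σ := by
  have h := spectralResolution_eigenProj hρ.1.isHermitian
  have h' := spectralResolution_eigenProj hσ.1.isHermitian
  rw [(h.tensor h').vonNeumannEntropy_eq (isHermitian_tensor hρ.1.isHermitian hσ.1.isHermitian),
    h.vonNeumannEntropy_eq hρ.1.isHermitian, h'.vonNeumannEntropy_eq hσ.1.isHermitian]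
  simp only [Fintype.sum_prod_type, mul_mul_logb_mul, Finset.sum_add_distrib, ← Finset.mul_sum,
    ← Finset.sum_mul, h.sum_eq_one hρ, h'.sum_eq_one hσ, mul_one, one_mul, neg_add]

theorem vonNeumannEntropy_copies {ρ : Op ι} (hρ : IsState ρ) (n : ℕ) :
    vonNeumannEntropy (copies ρ n) = n * vonNeumannEntropy ρ := by
  induction n with
  | zero =>
    have hpure : copies ρ 0 * copies ρ 0 = copies ρ 0 := by
      rw [copies_mul_copies]
      rfl
    rw [vonNeumannEntropy_of_mul_self (isState_copies hρ 0) hpure, Nat.cast_zero, zero_mul]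
  | succ n ih =>
    have hcopies := isState_copies hρ n
    rw [copies_succ, vonNeumannEntropy_submatrix
      (isHermitian_tensor hρ.1.isHermitian hcopies.1.isHermitian),
      vonNeumannEntropy_tensor hρ hcopies, ih]
    push_cast
    ring

end Entropy

section Additivity

theorem neg_logb_pow_div {n : ℕ} (hn : n ≠ 0) (b c : ℝ) :
    -Real.logb b (c ^ n) / n = -Real.logb b c := by
  rw [Real.logb_pow, ← mul_neg, mul_div_cancel_left₀ _ (Nat.cast_ne_zero.mpr hn)]

variable {P : Type} {ι : P → Type} [∀ l, Fintype (ι l)] [∀ l, DecidableEq (ι l)]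
variable {ρ σ : Op ι} {c : ℝ}

theorem isAdditive_of_copies_div_eq {V : Type} [Div V] [NatCast V] [TopologicalSpace V]
    {E : ∀ (κ : P → Type) [∀ l, Fintype (κ l)] [∀ l, DecidableEq (κ l)], Op κ → V}
    (h : ∀ n : ℕ, n ≠ 0 → E (fun l => Fin n → ι l) (copies ρ n) / (n : V) = E ι ρ) :
    IsAdditive E ρ :=
  tendsto_const_nhds.congr' <| (eventually_ne_atTop 0).mono fun n hn => (h n hn).symm

variable [Fintype P] [DecidableEq P]

namespace OverlapCertificate

theorem GM_eq (h : OverlapCertificate ρ σ c) : GM ι ρ = -Real.logb 2 c :=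
  GM_eq_of_isLUB h.pos.le h.isLUB_separableOverlaps

theorem REE_eq (h : OverlapCertificate ρ σ c) :
    REE ι ρ = ((-vonNeumannEntropy ρ - Real.logb 2 c : ℝ) : EReal) := by
  have hre : ∀ τ : Op ι, (ρ * (cfc (Real.logb 2) ρ - cfc (Real.logb 2) τ)).trace.re =
      -vonNeumannEntropy ρ - (ρ * cfc (Real.logb 2) τ).trace.re := fun τ => by
    rw [mul_sub, Matrix.trace_sub, Complex.sub_re, vonNeumannEntropy, neg_neg]
  refine le_antisymm (iInf₂_le_of_le σ h.mem_SEP ?_) (le_iInf₂ fun τ hτ => ?_)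
  · have hker : ∀ v, σ *ᵥ v = 0 → ρ *ᵥ v = 0 := fun v hv => by
      have := congrArg (· *ᵥ v) h.mul_eq_right
      simp only [← Matrix.mulVec_mulVec, hv, Matrix.mulVec_zero, Matrix.smul_mulVec] at this
      exact (smul_eq_zero.mp this.symm).resolve_left h.pos.ne'
    rw [relativeEntropy, if_pos hker, hre, Matrix.trace_mul_comm ρ (cfc (Real.logb 2) σ),
      cfc_mul_of_mul_eq_smul h.isState_right.1.isHermitian h.mul_eq, Matrix.trace_smul,
      h.isState.2, Complex.smul_re, Complex.one_re, smul_eq_mul, mul_one]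
  · rw [relativeEntropy]
    split_ifs with hker
    · rw [hre]
      exact EReal.coe_le_coe_iff.mpr (sub_le_sub_left (re_trace_mul_cfc_logb_le h.isState
        (isState_of_mem_SEP hτ).1 hker h.pos (productBound_iff_forall_mem_SEP.mp h.bound τ hτ)) _)
    · exact le_top

theorem isAdditive_GM (h : OverlapCertificate ρ σ c) : IsAdditive GM ρ :=
  isAdditive_of_copies_div_eq fun n hn => by
    rw [(h.copies n).GM_eq, h.GM_eq, neg_logb_pow_div hn]

theorem isAdditive_LGR (h : OverlapCertificate ρ σ c) (hpure : ρ * ρ = ρ) : IsAdditive LGR ρ :=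
  isAdditive_of_copies_div_eq fun n hn => by
    rw [(h.copies n).LGR_eq (by rw [copies_mul_copies, hpure]), h.LGR_eq hpure,
      neg_logb_pow_div hn]

theorem isAdditive_REE (h : OverlapCertificate ρ σ c) : IsAdditive REE ρ :=
  isAdditive_of_copies_div_eq fun n hn => by
    have hn' : (n : ℝ) ≠ 0 := Nat.cast_ne_zero.mpr hn
    rw [(h.copies n).REE_eq, h.REE_eq, vonNeumannEntropy_copies h.isState, Real.logb_pow,
      ← EReal.coe_coe_eq_natCast, ← EReal.coe_div, ← mul_neg, ← mul_sub,
      mul_div_cancel_left₀ _ hn']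

end OverlapCertificate

end Additivity

section Banach

open scoped RealInnerProductSpace

variable {E P : Type*} [NormedAddCommGroup E]

variable (E P) in
/-- Families of unit vectors of `E` indexed by `P`. -/
def unitFamilies : Set (P → E) :=
  Set.univ.pi fun _ => Metric.sphere 0 1

theorem mem_unitFamilies {c : P → E} : c ∈ unitFamilies E P ↔ ∀ l, ‖c l‖ = 1 := by
  simp [unitFamilies]

theorem update_mem_unitFamilies [DecidableEq P] {c : P → E} (hc : c ∈ unitFamilies E P) (l : P)
    {v : E} (hv : ‖v‖ = 1) : Function.update c l v ∈ unitFamilies E P := by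
  rw [mem_unitFamilies] at hc ⊢
  intro m
  rcases eq_or_ne m l with rfl | h
  · rwa [Function.update_self]
  · rw [Function.update_of_ne h, hc]

variable [InnerProductSpace ℝ E]

theorem eq_mul_inner_of_forall_abs_le [CompleteSpace E] {f : E →L[ℝ] ℝ} {a : E} (ha : ‖a‖ = 1)
    (h : ∀ v, |f v| ≤ |f a| * ‖v‖) (v : E) : f v = f a * ⟪a, v⟫ := by
  obtain ⟨y, rfl⟩ := (InnerProductSpace.toDual ℝ E).surjective f
  simp only [InnerProductSpace.toDual_apply_apply] at h ⊢
  have hy : ‖y‖ ≤ |⟪y, a⟫| := by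
    rcases (norm_nonneg y).eq_or_lt with h0 | h0
    · rw [← h0]
      positivity
    · refine le_of_mul_le_mul_right ?_ h0
      simpa [sq] using h y
  have hproj : y - ⟪y, a⟫ • a = 0 := by
    rw [← norm_eq_zero, ← sq_eq_zero_iff]
    refine le_antisymm ?_ (sq_nonneg _)
    rw [norm_sub_sq_real, inner_smul_right, norm_smul, ha, Real.norm_eq_abs, mul_one, sq_abs]
    nlinarith [sq_abs ⟪y, a⟫, norm_nonneg y]
  rw [← real_inner_smul_left, ← sub_eq_zero.mp hproj]

theorem norm_add_lt_two {a b : E} (ha : ‖a‖ = 1) (hb : ‖b‖ = 1) (hab : a ≠ b) : ‖a + b‖ < 2 := by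
  have hpar := parallelogram_law_with_norm ℝ a b
  have hpos : 0 < ‖a - b‖ := norm_pos_iff.mpr (sub_ne_zero.mpr hab)
  rw [ha, hb] at hpar
  nlinarith [norm_nonneg (a + b)]

theorem exists_eq_norm_smul_unit {a b : E} (ha : ‖a‖ = 1) :
    ∃ w : E, ‖w‖ = 1 ∧ a + b = ‖a + b‖ • w ∧ (a + b = 0 → w = a) := by
  by_cases h : a + b = 0
  · exact ⟨a, ha, by rw [h, norm_zero, zero_smul], fun _ => rfl⟩
  · have hnorm : ‖a + b‖ ≠ 0 := norm_ne_zero_iff.mpr h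
    exact ⟨‖a + b‖⁻¹ • (a + b), by rw [norm_smul, norm_inv, norm_norm, inv_mul_cancel₀ hnorm],
      (smul_inv_smul₀ hnorm _).symm, fun h' => absurd h' h⟩

theorem exists_sign_norm_lt {R w : E} {s : ℝ} (hw : ‖w‖ = 1) (hs0 : 0 ≤ s) (hs2 : s < 2) :
    ∃ u : E, (u = w ∨ u = -w) ∧ ‖R + s • w‖ < ‖R + (2 : ℝ) • u‖ := by
  have hexpand : ∀ r : ℝ, ‖R + r • w‖ ^ 2 = ‖R‖ ^ 2 + 2 * r * ⟪R, w⟫ + r ^ 2 := fun r => by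
    rw [norm_add_sq_real, inner_smul_right, norm_smul, hw, Real.norm_eq_abs, mul_one, sq_abs]
    ring
  rcases le_total 0 ⟪R, w⟫ with h | h
  · refine ⟨w, Or.inl rfl, lt_of_pow_lt_pow_left₀ 2 (norm_nonneg _) ?_⟩
    rw [hexpand, hexpand]
    nlinarith
  · refine ⟨-w, Or.inr rfl, lt_of_pow_lt_pow_left₀ 2 (norm_nonneg _) ?_⟩
    rw [smul_neg, ← neg_smul, hexpand, hexpand]
    nlinarith

theorem isCompact_unitFamilies [FiniteDimensional ℝ E] : IsCompact (unitFamilies E P) :=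
  have := FiniteDimensional.proper ℝ E
  isCompact_univ_pi fun _ => isCompact_sphere 0 1

theorem sum_update_update [Fintype P] [DecidableEq P] (c : P → E) {l m : P} (hlm : l ≠ m) (u : E) :
    ∑ k, Function.update (Function.update c l u) m u k =
      ∑ k, c k - (c l + c m) + (2 : ℝ) • u := by
  rw [Finset.sum_update_of_mem (Finset.mem_univ m), Finset.sum_update_of_mem (by simp [hlm]),
    Finset.sdiff_singleton_eq_erase, Finset.sdiff_singleton_eq_erase,
    ← Finset.add_sum_erase _ c (Finset.mem_univ m),
    ← Finset.add_sum_erase _ c (Finset.mem_erase.mpr ⟨hlm, Finset.mem_univ l⟩), two_smul]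
  abel

variable {F : ContinuousMultilinearMap ℝ (fun _ : P => E) ℝ} {c : P → E}

theorem map_update_of_isMaxOn [DecidableEq P] [CompleteSpace E] (hc : c ∈ unitFamilies E P)
    (hmax : IsMaxOn (fun c => |F c|) (unitFamilies E P) c) (l : P) (v : E) :
    F (Function.update c l v) = F c * ⟪c l, v⟫ := by
  have hself : F.toContinuousLinearMap c l (c l) = F c := by simp
  have hle : ∀ v, |F.toContinuousLinearMap c l v| ≤ |F.toContinuousLinearMap c l (c l)| * ‖v‖ := by
    intro v
    rcases eq_or_ne v 0 with rfl | hv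
    · simp [F.map_coord_zero (m := Function.update c l 0) l]
    have hv' : ‖v‖ ≠ 0 := norm_ne_zero_iff.mpr hv
    have hunit : |F (Function.update c l (‖v‖⁻¹ • v))| ≤ |F c| := hmax <|
      update_mem_unitFamilies hc l (by rw [norm_smul, norm_inv, norm_norm, inv_mul_cancel₀ hv'])
    rw [F.map_update_smul, smul_eq_mul, abs_mul, abs_inv, abs_norm,
      inv_mul_le_iff₀ (norm_pos_iff.mpr hv), mul_comm] at hunit
    rwa [hself]
  have := eq_mul_inner_of_forall_abs_le (mem_unitFamilies.mp hc l) hle v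
  rwa [hself] at this

theorem map_update_update_comm [DecidableEq P]
    (hsymm : ∀ (e : Equiv.Perm P) c, F (c ∘ e) = F c) (c : P → E) {l m : P} (hlm : l ≠ m)
    (v w : E) :
    F (Function.update (Function.update c l v) m w) =
      F (Function.update (Function.update c l w) m v) := by
  rw [← hsymm (Equiv.swap l m)]
  refine congrArg F (funext fun k => ?_)
  rcases eq_or_ne k m with rfl | hkm
  · simp [hlm]
  · rcases eq_or_ne k l with rfl | hkl
    · simp [hlm]
    · simp [hkm, hkl, Equiv.swap_apply_of_ne_of_ne hkl hkm]

/- With `a = c l` and `b = c m`, put the unit vector `w ∝ a + b` in both places: since the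
derivatives at a maximizer are known, `‖a + b‖ F(… w … w …) = F(… w … a + b …)` can be evaluated. -/
theorem abs_map_update_update_of_isMaxOn [DecidableEq P] [CompleteSpace E]
    (hsymm : ∀ (e : Equiv.Perm P) c, F (c ∘ e) = F c) (hc : c ∈ unitFamilies E P)
    (hmax : IsMaxOn (fun c => |F c|) (unitFamilies E P) c) {l m : P} (hlm : l ≠ m) {w : E}
    (hw : ‖w‖ = 1) (hadd : c l + c m = ‖c l + c m‖ • w) (hzero : c l + c m = 0 → w = c l) :
    |F (Function.update (Function.update c l w) m w)| = |F c| := by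
  have hright : ∀ v, F (Function.update (Function.update c l v) m (c m)) = F c * ⟪c l, v⟫ :=
    fun v => by
      rw [Function.update_comm hlm, Function.update_eq_self, map_update_of_isMaxOn hc hmax]
  have hleft : ∀ v, F (Function.update (Function.update c l (c l)) m v) = F c * ⟪c m, v⟫ :=
    fun v => by rw [Function.update_eq_self, map_update_of_isMaxOn hc hmax]
  by_cases h0 : c l + c m = 0
  · rw [hzero h0, hleft, eq_neg_of_add_eq_zero_right h0, inner_neg_left, real_inner_self_eq_norm_sq,
      mem_unitFamilies.mp hc l, one_pow, mul_neg_one, abs_neg]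
  · congr 1
    refine mul_left_cancel₀ (norm_ne_zero_iff.mpr h0) ?_
    calc ‖c l + c m‖ * F (Function.update (Function.update c l w) m w)
        = F (Function.update (Function.update c l w) m (c l + c m)) := by
          rw [hadd, F.map_update_smul, smul_eq_mul, ← hadd]
      _ = F c * ⟪c l + c m, w⟫ := by
          rw [F.map_update_add, hright, map_update_update_comm hsymm c hlm, hleft, inner_add_left]
          ring
      _ = ‖c l + c m‖ * F c := by
          rw [hadd, real_inner_smul_left, real_inner_self_eq_norm_sq, hw, ← hadd]
          ring

theorem exists_norm_sum_lt_of_isMaxOn [Fintype P] [CompleteSpace E]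
    (hsymm : ∀ (e : Equiv.Perm P) c, F (c ∘ e) = F c) (hc : c ∈ unitFamilies E P)
    (hmax : IsMaxOn (fun c => |F c|) (unitFamilies E P) c) {l m : P} (hne : c l ≠ c m) :
    ∃ c' ∈ unitFamilies E P, |F c'| = |F c| ∧ ‖∑ k, c k‖ < ‖∑ k, c' k‖ := by
  classical
  have hlm : l ≠ m := fun h => hne (h ▸ rfl)
  have hunit := mem_unitFamilies.mp hc
  obtain ⟨w, hw, hadd, hzero⟩ := exists_eq_norm_smul_unit (b := c m) (hunit l)
  obtain ⟨u, hu, hlt⟩ := exists_sign_norm_lt (R := ∑ k, c k - (c l + c m)) hw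
    (norm_nonneg (c l + c m)) (norm_add_lt_two (hunit l) (hunit m) hne)
  have hu1 : ‖u‖ = 1 := by rcases hu with rfl | rfl <;> simp [hw]
  refine ⟨Function.update (Function.update c l u) m u,
    update_mem_unitFamilies (update_mem_unitFamilies hc l hu1) m hu1, ?_, ?_⟩
  · rw [← abs_map_update_update_of_isMaxOn hsymm hc hmax hlm hw hadd hzero]
    rcases hu with rfl | rfl
    · rfl
    · rw [← neg_one_smul ℝ w, F.map_update_smul, Function.update_comm hlm, F.map_update_smul,
        Function.update_comm hlm.symm, smul_smul, neg_one_mul, neg_neg, one_smul]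
  · rwa [← hadd, sub_add_cancel, ← sum_update_update c hlm] at hlt

theorem exists_isMaxOn_const [Finite P] [FiniteDimensional ℝ E]
    (hsymm : ∀ (e : Equiv.Perm P) c, F (c ∘ e) = F c) (hne : (unitFamilies E P).Nonempty) :
    ∃ c ∈ unitFamilies E P, IsMaxOn (fun c => |F c|) (unitFamilies E P) c ∧ ∀ l m, c l = c m := by
  have := Fintype.ofFinite P
  have hcont : Continuous fun c => |F c| := F.cont.abs
  obtain ⟨c₁, hc₁, hmax₁⟩ := isCompact_unitFamilies.exists_isMaxOn hne hcont.continuousOn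
  obtain ⟨c₂, ⟨hc₂, hF₂⟩, hmax₂⟩ := (isCompact_unitFamilies.inter_right
    (isClosed_singleton.preimage hcont (t := {|F c₁|}))).exists_isMaxOn ⟨c₁, hc₁, rfl⟩
    (by fun_prop : Continuous fun c : P → E => ‖∑ l, c l‖).continuousOn
  have hmax : IsMaxOn (fun c => |F c|) (unitFamilies E P) c₂ := fun x hx =>
    (hmax₁ hx).trans_eq hF₂.symm
  refine ⟨c₂, hc₂, hmax, fun l m => ?_⟩
  by_contra hlm
  have := FiniteDimensional.complete ℝ E
  obtain ⟨c', hc', hF', hlt⟩ := exists_norm_sum_lt_of_isMaxOn hsymm hc₂ hmax hlm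
  exact hlt.not_ge (hmax₂ ⟨hc', hF'.trans hF₂⟩)

theorem abs_map_le_of_forall_const_of_mem_unitFamilies [Fintype P] [FiniteDimensional ℝ E]
    (hsymm : ∀ (e : Equiv.Perm P) c, F (c ∘ e) = F c) {B : ℝ}
    (hB : ∀ u, |F fun _ => u| ≤ B * ‖u‖ ^ Fintype.card P) (hc : c ∈ unitFamilies E P) :
    |F c| ≤ B := by
  obtain ⟨c', hc', hmax, hconst⟩ := exists_isMaxOn_const hsymm ⟨c, hc⟩
  have hle : |F c| ≤ |F c'| := hmax hc
  refine hle.trans ?_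
  rcases isEmpty_or_nonempty P with hP | ⟨⟨l⟩⟩
  · rw [Subsingleton.elim c' fun _ => 0]
    simpa using hB 0
  · rw [show c' = fun _ => c' l from funext fun m => hconst m l]
    simpa [mem_unitFamilies.mp hc' l] using hB (c' l)

theorem abs_map_le_of_forall_const [Fintype P] [FiniteDimensional ℝ E]
    (hsymm : ∀ (e : Equiv.Perm P) c, F (c ∘ e) = F c) {B : ℝ}
    (hB : ∀ u, |F fun _ => u| ≤ B * ‖u‖ ^ Fintype.card P) (c : P → E) :
    |F c| ≤ B * ∏ l, ‖c l‖ := by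
  by_cases h0 : ∃ l, c l = 0
  · obtain ⟨l, hl⟩ := h0
    rw [F.map_coord_zero l hl, Finset.prod_eq_zero (Finset.mem_univ l) (by rw [hl, norm_zero])]
    simp
  · push Not at h0
    have hnorm : ∀ l, ‖c l‖ ≠ 0 := fun l => norm_ne_zero_iff.mpr (h0 l)
    have hscale : F c = (∏ l, ‖c l‖) * F fun l => ‖c l‖⁻¹ • c l := by
      rw [F.map_smul_univ, smul_eq_mul, ← mul_assoc, ← Finset.prod_mul_distrib,
        Finset.prod_eq_one fun l _ => mul_inv_cancel₀ (hnorm l), one_mul]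
    rw [hscale, abs_mul, abs_of_nonneg (Finset.prod_nonneg fun l _ => norm_nonneg _), mul_comm B]
    gcongr
    refine abs_map_le_of_forall_const_of_mem_unitFamilies hsymm hB ?_
    refine mem_unitFamilies.mpr fun l => ?_
    rw [norm_smul, norm_inv, norm_norm, inv_mul_cancel₀ (hnorm l)]

end Banach

section Likelihood

variable {α : Type*} [Fintype α] {N : ℕ} {k : α → ℕ}

theorem sum_div_eq_one (hN : N ≠ 0) (hk : ∑ j, k j = N) : ∑ j, (k j : ℝ) / N = 1 := by
  rw [← Finset.sum_div, ← Nat.cast_sum, hk, div_self (Nat.cast_ne_zero.mpr hN)]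

theorem prod_div_pow_pos (hk : ∑ j, k j = N) : 0 < ∏ j, ((k j : ℝ) / N) ^ k j := by
  refine Finset.prod_pos fun j _ => ?_
  rcases (k j).eq_zero_or_pos with hj | hj
  · simp [hj]
  · have hN : 0 < N := hj.trans_le (hk ▸ Finset.single_le_sum_of_canonicallyOrdered
      (Finset.mem_univ j))
    positivity

theorem prod_pow_le_prod_div_pow_mul_sum_pow (hk : ∑ j, k j = N) {p : α → ℝ} (hp : ∀ j, 0 ≤ p j) :
    ∏ j, p j ^ k j ≤ (∏ j, ((k j : ℝ) / N) ^ k j) * (∑ j, p j) ^ N := by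
  rcases N.eq_zero_or_pos with rfl | hN
  · simp [fun j => Finset.sum_eq_zero_iff.mp hk j (Finset.mem_univ j)]
  set w : α → ℝ := fun j => k j / N with hw
  have hN0 : (N : ℝ) ≠ 0 := by positivity
  have hw0 : ∀ j, 0 ≤ w j := fun j => by positivity
  have hz0 : ∀ j, 0 ≤ p j / w j := fun j => div_nonneg (hp j) (hw0 j)
  have hw1 : ∑ j, w j = 1 := sum_div_eq_one hN.ne' hk
  have hmean : ∏ j, (p j / w j) ^ w j ≤ ∑ j, p j :=
    (Real.geom_mean_le_arith_mean_weighted _ w _ (fun j _ => hw0 j) hw1 fun j _ => hz0 j).trans <|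
      Finset.sum_le_sum fun j _ => by
        rcases eq_or_ne (w j) 0 with hwj | hwj
        · simpa [hwj] using hp j
        · rw [mul_div_cancel₀ _ hwj]
  have hfactor : ∀ j, p j ^ k j = w j ^ k j * ((p j / w j) ^ w j) ^ N := fun j => by
    rcases (k j).eq_zero_or_pos with hj | hj
    · simp [hw, hj]
    · have hwj : w j ≠ 0 := by positivity
      rw [← Real.rpow_mul_natCast (hz0 j), hw, div_mul_cancel₀ _ hN0, Real.rpow_natCast, ← mul_pow,
        mul_div_cancel₀ _ hwj]
  rw [Finset.prod_congr rfl fun j _ => hfactor j, Finset.prod_mul_distrib, Finset.prod_pow]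
  gcongr
  exact Finset.prod_nonneg fun j _ => Real.rpow_nonneg (hz0 j) _

end Likelihood

section Words

variable {P α : Type*} [Fintype P] [DecidableEq α]

/-- The type of the word `x`: the number of occurrences of each symbol. -/
def occ (x : P → α) (j : α) : ℕ := (Finset.univ.filter fun l => x l = j).card

theorem occ_le (x : P → α) (j : α) : occ x j ≤ Fintype.card P :=
  Finset.card_le_univ _

theorem occ_comp_perm (e : Equiv.Perm P) (x : P → α) : occ (x ∘ e) = occ x :=
  funext fun _ => Finset.card_equiv e (by simp)

variable [Fintype α]

theorem prod_comp_eq_prod_pow_occ {M : Type*} [CommMonoid M] (u : α → M) (x : P → α) :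
    ∏ l, u (x l) = ∏ j, u j ^ occ x j := by
  rw [← Finset.prod_fiberwise' Finset.univ x u]
  simp [occ]

variable [DecidableEq P] {k : α → ℕ}

variable (P) in
/-- The words of type `k`, with letters indexed by `P`. -/
def words (k : α → ℕ) : Finset (P → α) :=
  Finset.univ.filter fun x => occ x = k

theorem mem_words {x : P → α} : x ∈ words P k ↔ occ x = k := by
  simp [words]

theorem sum_X_pow_eq_sum_monomial_occ :
    (∑ j : α, MvPolynomial.X j : MvPolynomial α ℕ) ^ Fintype.card P =
      ∑ x : P → α, MvPolynomial.monomial (Finsupp.equivFunOnFinite.symm (occ x)) 1 := by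
  rw [← Finset.card_univ, ← Finset.prod_const, Fintype.prod_sum]
  refine Finset.sum_congr rfl fun x _ => ?_
  rw [prod_comp_eq_prod_pow_occ, MvPolynomial.monomial_eq, Finsupp.prod_fintype _ _ (by simp)]
  simp

theorem card_words (hk : ∑ j, k j = Fintype.card P) :
    (words P k).card = Nat.multinomial Finset.univ k := by
  have hcoeff := congrArg (MvPolynomial.coeff (Finsupp.equivFunOnFinite.symm k))
    (sum_X_pow_eq_sum_monomial_occ (P := P) (α := α))
  rw [MvPolynomial.coeff_sum_X_pow_of_fintype,
    if_pos (by rwa [Finsupp.sum_fintype _ _ fun _ => rfl]), MvPolynomial.coeff_sum,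
    ← Finsupp.multinomial_of_support_subset (Finset.subset_univ _)] at hcoeff
  simpa [words, MvPolynomial.coeff_monomial] using hcoeff.symm

theorem card_words_pos (hk : ∑ j, k j = Fintype.card P) : 0 < (words P k).card := by
  rw [card_words hk]
  exact Nat.multinomial_pos _ _

end Words

section TypeVectors

variable {P α : Type} [Fintype P] [Fintype α] [DecidableEq P] [DecidableEq α] {k : α → ℕ}

variable (P) in
/-- The normalized uniform superposition of the words of type `k`: the Dicke vector with
occupation numbers `k`, for an arbitrary set of parties and an arbitrary alphabet. -/
def typeVec (k : α → ℕ) (x : P → α) : ℂ :=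
  if occ x = k then ((1 / √((words P k).card : ℝ) : ℝ) : ℂ) else 0

variable (P) in
/-- The pure state of `typeVec P k`. -/
def typeProj (k : α → ℕ) : Matrix (P → α) (P → α) ℂ :=
  Matrix.vecMulVec (typeVec P k) (star (typeVec P k))

variable (P) in
/-- The largest overlap `|⟨φ|k⟩|²` of `typeVec P k` with product vectors; it is attained at
`φ = (∑ⱼ √(k j / N) |j⟩)^{⊗N}`, where `N` is the number of parties. -/
def typeOverlap (k : α → ℕ) : ℝ :=
  (words P k).card * ∏ j, ((k j : ℝ) / Fintype.card P) ^ k j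

theorem typeVec_nonneg (k : α → ℕ) (x : P → α) : 0 ≤ typeVec P k x := by
  rw [typeVec]
  split_ifs
  · exact Complex.zero_le_real.mpr (by positivity)
  · exact le_rfl

theorem star_typeVec (k : α → ℕ) : star (typeVec P k) = typeVec P k :=
  funext fun x => Complex.conj_eq_iff_im.mpr (Complex.nonneg_iff.mp (typeVec_nonneg k x)).2.symm

theorem typeProj_entry_nonneg (k : α → ℕ) (x y : P → α) : 0 ≤ typeProj P k x y := by
  rw [typeProj, star_typeVec]
  exact mul_nonneg (typeVec_nonneg k x) (typeVec_nonneg k y)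

theorem norm_typeVec (k : α → ℕ) (x : P → α) :
    ‖typeVec P k x‖ = if x ∈ words P k then 1 / √((words P k).card : ℝ) else 0 := by
  simp only [typeVec, mem_words]
  split_ifs
  · rw [Complex.norm_real, Real.norm_of_nonneg (by positivity)]
  · exact norm_zero

theorem sum_norm_sq_typeVec (hk : ∑ j, k j = Fintype.card P) : ∑ x, ‖typeVec P k x‖ ^ 2 = 1 := by
  have hcard : ((words P k).card : ℝ) ≠ 0 := by exact_mod_cast (card_words_pos hk).ne'
  simp only [norm_typeVec, ite_pow, ne_eq, OfNat.ofNat_ne_zero, not_false_eq_true, zero_pow,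
    Finset.sum_ite_mem, Finset.univ_inter, Finset.sum_const, nsmul_eq_mul, div_pow, one_pow,
    Real.sq_sqrt (Nat.cast_nonneg _), mul_one_div, div_self hcard]

theorem star_typeVec_dotProduct_of_ne {k k' : α → ℕ} (h : k ≠ k') :
    star (typeVec P k) ⬝ᵥ typeVec P k' = 0 := by
  rw [star_typeVec]
  refine Finset.sum_eq_zero fun x _ => ?_
  simp only [typeVec]
  split_ifs with hk hk'
  · exact absurd (hk.symm.trans hk') h
  all_goals simp

theorem typeProj_mul_typeProj_of_ne {k k' : α → ℕ} (h : k ≠ k') :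
    typeProj P k * typeProj P k' = 0 := by
  rw [typeProj, typeProj, Matrix.vecMulVec_mul_vecMulVec, star_typeVec_dotProduct_of_ne h,
    zero_smul, Matrix.vecMulVec_zero]

theorem isState_typeProj (hk : ∑ j, k j = Fintype.card P) : IsState (typeProj P k) :=
  isState_vecMulVec_star (sum_norm_sq_typeVec hk)

theorem typeProj_mul_self (hk : ∑ j, k j = Fintype.card P) :
    typeProj P k * typeProj P k = typeProj P k := by
  rw [typeProj, Matrix.vecMulVec_mul_vecMulVec, star_dotProduct_self, sum_norm_sq_typeVec hk,
    Complex.ofReal_one, one_smul]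

end TypeVectors

section Dephasing

variable {P α : Type} [Fintype α]

/-- The vector `∑ⱼ √(q j) ω^(θ j) |j⟩` with `ω` a primitive `(N + 1)`-st root of unity.
Averaging the projector onto its `N`-th tensor power over `θ` removes the coherences between words
of different types. -/
def phaseVec {N : ℕ} (q : α → ℝ) (θ : α → ZMod (N + 1)) (j : α) : ℂ :=
  √(q j) * ZMod.stdAddChar (θ j)

theorem sum_norm_sq_phaseVec {N : ℕ} {q : α → ℝ} (hq : ∀ j, 0 ≤ q j) (hq1 : ∑ j, q j = 1)
    (θ : α → ZMod (N + 1)) : ∑ j, ‖phaseVec q θ j‖ ^ 2 = 1 := by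
  rw [← hq1]
  refine Finset.sum_congr rfl fun j _ => ?_
  rw [phaseVec, norm_mul, ZMod.stdAddChar_apply, Circle.norm_coe, mul_one, Complex.norm_real,
    Real.norm_of_nonneg (Real.sqrt_nonneg _), Real.sq_sqrt (hq j)]

theorem stdAddChar_pow_mul_star_pow {N : ℕ} (t : ZMod (N + 1)) (a b : ℕ) :
    ZMod.stdAddChar t ^ a * star (ZMod.stdAddChar t) ^ b =
      ZMod.stdAddChar (t * ((a : ZMod (N + 1)) - (b : ZMod (N + 1)))) := by
  rw [Complex.star_def, ← AddChar.map_neg_eq_conj, ← AddChar.map_nsmul_eq_pow,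
    ← AddChar.map_nsmul_eq_pow, ← AddChar.map_add_eq_mul, nsmul_eq_mul, nsmul_eq_mul]
  congr 1
  ring

theorem sum_stdAddChar_pow_mul_star_pow {N a b : ℕ} (ha : a ≤ N) (hb : b ≤ N) :
    ∑ t : ZMod (N + 1), ZMod.stdAddChar t ^ a * star (ZMod.stdAddChar t) ^ b =
      if a = b then (N + 1 : ℂ) else 0 := by
  simp only [stdAddChar_pow_mul_star_pow,
    AddChar.sum_mulShift _ (ZMod.isPrimitive_stdAddChar (N + 1)), sub_eq_zero,
    ZMod.natCast_eq_natCast_iff', Nat.mod_eq_of_lt (Nat.lt_succ_of_le ha),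
    Nat.mod_eq_of_lt (Nat.lt_succ_of_le hb), ZMod.card]
  push_cast
  rfl

theorem sum_phase_pow_mul_star_pow {N a b : ℕ} (ha : a ≤ N) (hb : b ≤ N) {r : ℝ} (hr : 0 ≤ r) :
    ∑ t : ZMod (N + 1), ((√r : ℂ) * ZMod.stdAddChar t) ^ a * star ((√r : ℂ) * ZMod.stdAddChar t) ^ b
      = if a = b then (N + 1 : ℂ) * (r : ℂ) ^ a else 0 := by
  have hterm : ∀ t : ZMod (N + 1),
      ((√r : ℂ) * ZMod.stdAddChar t) ^ a * star ((√r : ℂ) * ZMod.stdAddChar t) ^ b =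
        (√r : ℂ) ^ (a + b) * (ZMod.stdAddChar t ^ a * star (ZMod.stdAddChar t) ^ b) := fun t => by
    rw [star_mul', Complex.star_def, Complex.conj_ofReal]
    ring
  simp only [hterm, ← Finset.mul_sum, sum_stdAddChar_pow_mul_star_pow ha hb]
  split_ifs with hab
  · rw [← hab, ← two_mul, pow_mul, ← Complex.ofReal_pow, Real.sq_sqrt hr, mul_comm]
  · rw [mul_zero]

variable [Fintype P] [DecidableEq α]

variable (P) in
/-- The pure product state `(∑ⱼ √(q j) |j⟩)^{⊗N}`, dephased between words of different types. -/
def dephasedProduct (q : α → ℝ) : Matrix (P → α) (P → α) ℂ :=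
  fun x y => if occ x = occ y then ((∏ j, q j ^ occ x j : ℝ) : ℂ) else 0

theorem dephasedProduct_mul_typeProj [DecidableEq P] (q : α → ℝ) (k : α → ℕ) :
    dephasedProduct P q * typeProj P k =
      ((words P k).card * ∏ j, q j ^ k j : ℝ) • typeProj P k := by
  have hvec : dephasedProduct P q *ᵥ typeVec P k =
      ((words P k).card * ∏ j, q j ^ k j : ℝ) • typeVec P k := by
    ext x
    have hterm : ∀ y, dephasedProduct P q x y * typeVec P k y =
        if y ∈ words P k then ((∏ j, q j ^ k j : ℝ) : ℂ) * typeVec P k x else 0 := fun y => by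
      simp only [dephasedProduct, typeVec, mem_words]
      split_ifs <;> simp_all
    simp only [Matrix.mulVec, dotProduct, hterm, Finset.sum_ite_mem, Finset.univ_inter,
      Finset.sum_const, Pi.smul_apply, Complex.real_smul, nsmul_eq_mul]
    push_cast
    ring
  rw [typeProj, Matrix.mul_vecMulVec, hvec, Matrix.smul_vecMulVec]

theorem sum_prodVec_phaseVec {q : α → ℝ} (hq : ∀ j, 0 ≤ q j) (x y : P → α) :
    ∑ θ : α → ZMod (Fintype.card P + 1), prodVec (fun _ : P => phaseVec q θ) x *
        star (prodVec (fun _ : P => phaseVec q θ) y) =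
      (Fintype.card P + 1 : ℂ) ^ Fintype.card α * dephasedProduct P q x y := by
  have hterm : ∀ θ : α → ZMod (Fintype.card P + 1), prodVec (fun _ : P => phaseVec q θ) x *
      star (prodVec (fun _ : P => phaseVec q θ) y) =
        ∏ j, phaseVec q θ j ^ occ x j * star (phaseVec q θ j) ^ occ y j := fun θ => by
    rw [prodVec, prodVec, prod_comp_eq_prod_pow_occ, prod_comp_eq_prod_pow_occ, star_prod,
      Finset.prod_mul_distrib]
    simp only [star_pow]
  rw [Finset.sum_congr rfl fun θ _ => hterm θ, dephasedProduct]
  simp only [phaseVec]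
  rw [← Fintype.prod_sum fun j (t : ZMod (Fintype.card P + 1)) =>
    ((√(q j) : ℂ) * ZMod.stdAddChar t) ^ occ x j *
      star ((√(q j) : ℂ) * ZMod.stdAddChar t) ^ occ y j]
  simp only [sum_phase_pow_mul_star_pow (occ_le x _) (occ_le y _) (hq _)]
  split_ifs with hxy
  · simp only [hxy, if_true, Finset.prod_mul_distrib, Finset.prod_const, Finset.card_univ]
    push_cast
    rfl
  · obtain ⟨j, hj⟩ := Function.ne_iff.mp hxy
    rw [Finset.prod_eq_zero (Finset.mem_univ j) (if_neg hj), mul_zero]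

theorem dephasedProduct_mem_SEP {q : α → ℝ} (hq : ∀ j, 0 ≤ q j)
    (hq1 : ∑ j, q j = 1) : dephasedProduct P q ∈ SEP fun _ : P => α := by
  set K : ℝ := (Fintype.card P + 1) ^ Fintype.card α with hK
  have hK0 : K ≠ 0 := by positivity
  have haverage : dephasedProduct P q = ∑ θ : α → ZMod (Fintype.card P + 1),
      K⁻¹ • Matrix.vecMulVec (prodVec fun _ : P => phaseVec q θ)
        (star (prodVec fun _ : P => phaseVec q θ)) := by
    rw [← Finset.smul_sum, eq_inv_smul_iff₀ hK0]
    ext x y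
    simp only [Matrix.sum_apply, Matrix.smul_apply, Matrix.vecMulVec_apply, Pi.star_apply,
      sum_prodVec_phaseVec hq, Complex.real_smul, hK]
    push_cast
    rfl
  rw [haverage]
  refine (convex_convexHull ℝ _).sum_mem (fun _ _ => by positivity) ?_ fun θ _ =>
    vecMulVec_prodVec_mem_SEP fun _ => sum_norm_sq_phaseVec hq hq1 θ
  rw [Finset.sum_const, nsmul_eq_mul, Finset.card_univ, Fintype.card_fun, ZMod.card, hK]
  push_cast
  exact mul_inv_cancel₀ (by positivity)

end Dephasing

section DickeBound

variable {P α : Type} [Fintype P] [Fintype α] [DecidableEq P] [DecidableEq α] {k : α → ℕ}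

theorem typeOverlap_pos (hk : ∑ j, k j = Fintype.card P) : 0 < typeOverlap P k :=
  mul_pos (Nat.cast_pos.mpr (card_words_pos hk)) (prod_div_pow_pos hk)

variable (P) in
/-- The symmetric multilinear form `c ↦ ∑_{x ∈ words P k} ∏ₗ c l (x l)`, which up to
normalization is the overlap of `typeVec P k` with a real product vector. -/
def wordForm (k : α → ℕ) : ContinuousMultilinearMap ℝ (fun _ : P => EuclideanSpace ℝ α) ℝ :=
  ∑ x ∈ words P k, (ContinuousMultilinearMap.mkPiAlgebra ℝ P ℝ).compContinuousLinearMap fun l =>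
    EuclideanSpace.proj (x l)

theorem wordForm_apply (k : α → ℕ) (c : P → EuclideanSpace ℝ α) :
    wordForm P k c = ∑ x ∈ words P k, ∏ l, c l (x l) := by
  simp [wordForm]

theorem wordForm_comp_perm (k : α → ℕ) (e : Equiv.Perm P) (c : P → EuclideanSpace ℝ α) :
    wordForm P k (c ∘ e) = wordForm P k c := by
  rw [wordForm_apply, wordForm_apply]
  refine Finset.sum_equiv (e.arrowCongr (Equiv.refl α)) (fun x => ?_) fun x _ => ?_
  · rw [mem_words, mem_words, ← occ_comp_perm e.symm x]
    rfl
  · rw [← Equiv.prod_comp e fun l => c l (e.arrowCongr (Equiv.refl α) x l)]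
    simp only [Function.comp_apply, Equiv.arrowCongr_apply, Equiv.coe_refl, id_eq,
      Equiv.symm_apply_apply]

theorem abs_wordForm_const_le (hk : ∑ j, k j = Fintype.card P) (u : EuclideanSpace ℝ α) :
    |wordForm P k fun _ => u| ≤ (words P k).card * √(∏ j, ((k j : ℝ) / Fintype.card P) ^ k j) *
      ‖u‖ ^ Fintype.card P := by
  have hterm : ∀ x ∈ words P k, ∏ l, u (x l) = ∏ j, u j ^ k j := fun x hx => by
    rw [prod_comp_eq_prod_pow_occ, mem_words.mp hx]
  rw [wordForm_apply, Finset.sum_congr rfl hterm, Finset.sum_const, nsmul_eq_mul, abs_mul,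
    Nat.abs_cast, mul_assoc]
  gcongr
  refine abs_le_of_sq_le_sq ?_ (by positivity)
  calc (∏ j, u j ^ k j) ^ 2 = ∏ j, (u j ^ 2) ^ k j := by
        simp only [← Finset.prod_pow, ← pow_mul, mul_comm]
    _ ≤ (∏ j, ((k j : ℝ) / Fintype.card P) ^ k j) * (∑ j, u j ^ 2) ^ Fintype.card P :=
        prod_pow_le_prod_div_pow_mul_sum_pow hk fun j => sq_nonneg _
    _ = (√(∏ j, ((k j : ℝ) / Fintype.card P) ^ k j) * ‖u‖ ^ Fintype.card P) ^ 2 := by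
        rw [mul_pow, Real.sq_sqrt (prod_div_pow_pos hk).le, ← pow_mul, mul_comm _ 2, pow_mul,
          EuclideanSpace.real_norm_sq_eq]

theorem norm_star_typeVec_dotProduct_prodVec_le (hk : ∑ j, k j = Fintype.card P)
    (a : P → α → ℂ) :
    ‖star (typeVec P k) ⬝ᵥ prodVec a‖ ≤ √(typeOverlap P k) * ∏ l, √(∑ j, ‖a l j‖ ^ 2) := by
  set c : P → EuclideanSpace ℝ α := fun l => WithLp.toLp 2 fun j => ‖a l j‖ with hc
  have hcnorm : ∀ l, ‖c l‖ = √(∑ j, ‖a l j‖ ^ 2) := fun l => by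
    simp [hc, EuclideanSpace.norm_eq]
  have hcard : (0 : ℝ) < (words P k).card := Nat.cast_pos.mpr (card_words_pos hk)
  calc ‖star (typeVec P k) ⬝ᵥ prodVec a‖
      ≤ ∑ x, ‖typeVec P k x‖ * ∏ l, ‖a l (x l)‖ := by
        refine (norm_sum_le _ _).trans_eq (Finset.sum_congr rfl fun x _ => ?_)
        rw [norm_mul, Pi.star_apply, norm_star, prodVec, norm_prod]
    _ = 1 / √((words P k).card : ℝ) * wordForm P k c := by
        simp only [norm_typeVec, ite_mul, zero_mul, Finset.sum_ite_mem, Finset.univ_inter,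
          ← Finset.mul_sum, wordForm_apply, hc]
    _ ≤ 1 / √((words P k).card : ℝ) * ((words P k).card *
          √(∏ j, ((k j : ℝ) / Fintype.card P) ^ k j) * ∏ l, ‖c l‖) := by
        gcongr
        exact (le_abs_self _).trans <| abs_map_le_of_forall_const (wordForm_comp_perm k)
          (abs_wordForm_const_le hk) c
    _ = √(typeOverlap P k) * ∏ l, √(∑ j, ‖a l j‖ ^ 2) := by
        simp only [hcnorm, typeOverlap, Real.sqrt_mul hcard.le, ← mul_assoc, one_div_mul_eq_div,
          Real.div_sqrt]

theorem productBound_typeProj (hk : ∑ j, k j = Fintype.card P) :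
    ProductBound (ι := fun _ : P => α) (typeProj P k) (typeOverlap P k) := by
  refine productBound_vecMulVec_star_iff.mpr fun a => ?_
  calc ‖star (typeVec P k) ⬝ᵥ prodVec a‖ ^ 2
      ≤ (√(typeOverlap P k) * ∏ l, √(∑ j, ‖a l j‖ ^ 2)) ^ 2 := by
        gcongr
        exact norm_star_typeVec_dotProduct_prodVec_le hk a
    _ = typeOverlap P k * ∏ l, ∑ j, ‖a l j‖ ^ 2 := by
        rw [mul_pow, Real.sq_sqrt (typeOverlap_pos hk).le, ← Finset.prod_pow]
        simp only [Real.sq_sqrt (sum_norm_sq_nonneg _)]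

theorem overlapCertificate_typeProj [Nonempty P] (hk : ∑ j, k j = Fintype.card P) :
    OverlapCertificate (ι := fun _ : P => α) (typeProj P k)
      (dephasedProduct P fun j => (k j : ℝ) / Fintype.card P) (typeOverlap P k) where
  isState := isState_typeProj hk
  entry_nonneg := typeProj_entry_nonneg k
  bound := productBound_typeProj hk
  mem_SEP := dephasedProduct_mem_SEP (fun j => by positivity)
    (sum_div_eq_one Fintype.card_ne_zero hk)
  mul_eq := dephasedProduct_mul_typeProj _ k

end DickeBound

section PartialTrace

variable {P : Type} [DecidableEq P] {ι : P → Type}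

/-- The component `(⟨s|ᵢ ⊗ 1)|ψ⟩` of a vector, over the parties other than `i`. -/
def slice (i : P) (ψ : (∀ l, ι l) → ℂ) (s : ι i) (x : ∀ l : {l : P // l ≠ i}, ι l) : ℂ :=
  ψ ((Equiv.piSplitAt i ι).symm (s, x))

theorem slice_prodVec [Fintype P] (i : P) (b : ∀ l, ι l → ℂ) (s : ι i) :
    slice i (prodVec b) s = b i s • prodVec fun l : {l : P // l ≠ i} => b l := by
  ext x
  simp only [slice, prodVec, Fintype.prod_eq_mul_prod_subtype_ne _ i, Pi.smul_apply, smul_eq_mul]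
  congr 1
  · simp
  · exact Finset.prod_congr rfl fun l _ => by simp [l.2]

variable [∀ l, Fintype (ι l)]

theorem reduced_vecMulVec_star (i : P) (ψ : (∀ l, ι l) → ℂ) :
    reduced i (Matrix.vecMulVec ψ (star ψ)) =
      ∑ s, Matrix.vecMulVec (slice i ψ s) (star (slice i ψ s)) := by
  ext x y
  rw [Matrix.sum_apply]
  rfl

variable [Fintype P]

theorem trace_reduced (i : P) (ρ : Op ι) : (reduced i ρ).trace = ρ.trace := by
  rw [Matrix.trace, Matrix.trace, ← (Equiv.piSplitAt i ι).symm.sum_comp,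
    Fintype.sum_prod_type_right]
  rfl

theorem isState_reduced (i : P) {ρ : Op ι} (hρ : IsState ρ) : IsState (reduced i ρ) := by
  refine ⟨?_, (trace_reduced i ρ).trans hρ.2⟩
  have hsum : reduced i ρ = ∑ s, ρ.submatrix (fun x => (Equiv.piSplitAt i ι).symm (s, x))
      fun x => (Equiv.piSplitAt i ι).symm (s, x) := by
    ext x y
    rw [Matrix.sum_apply]
    rfl
  exact hsum ▸ Matrix.posSemidef_sum _ fun s _ => hρ.1.submatrix _

theorem dotProduct_eq_sum_slice (i : P) (χ ψ : (∀ l, ι l) → ℂ) :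
    star χ ⬝ᵥ ψ = ∑ s, star (slice i χ s) ⬝ᵥ slice i ψ s := by
  rw [dotProduct, ← (Equiv.piSplitAt i ι).symm.sum_comp, Fintype.sum_prod_type]
  rfl

-- The partial overlaps of `ψ` with `a`, conjugated, are the best choice of a vector for party `i`.
theorem ProductBound.reduced_vecMulVec_star {ψ : (∀ l, ι l) → ℂ} {c : ℝ} (hc : 0 ≤ c)
    (h : ProductBound (ι := ι) (Matrix.vecMulVec ψ (star ψ)) c) (i : P) :
    ProductBound (reduced i (Matrix.vecMulVec ψ (star ψ))) c := by
  intro a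
  set β : ι i → ℂ := fun s => star (slice i ψ s) ⬝ᵥ prodVec a
  set R : ℝ := ∑ s, ‖β s‖ ^ 2
  have hR0 : 0 ≤ R := sum_norm_sq_nonneg β
  have hform :
      (star (prodVec a) ⬝ᵥ reduced i (Matrix.vecMulVec ψ (star ψ)) *ᵥ prodVec a).re = R := by
    rw [MultipartiteEntanglement.reduced_vecMulVec_star, Matrix.sum_mulVec, dotProduct_sum,
      Complex.re_sum]
    exact Finset.sum_congr rfl fun s _ => re_dotProduct_vecMulVec_star_mulVec _ _
  obtain ⟨b, hbi, hba⟩ : ∃ b : ∀ l, ι l → ℂ, b i = star β ∧ (fun l : {l // l ≠ i} => b l) = a := by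
    refine ⟨(Equiv.piSplitAt i fun l => ι l → ℂ).symm (star β, a), by simp, ?_⟩
    ext l j
    simp [l.2]
  have hoverlap : star ψ ⬝ᵥ prodVec b = R := by
    simp only [dotProduct_eq_sum_slice i, slice_prodVec, hba, dotProduct_smul, hbi,
      Pi.star_apply, smul_eq_mul]
    exact star_dotProduct_self β
  have hbound := productBound_vecMulVec_star_iff.mp h b
  rw [hoverlap, Complex.norm_real, Real.norm_of_nonneg hR0,
    Fintype.prod_eq_mul_prod_subtype_ne _ i, hbi] at hbound
  have hprod : ∏ l : {l // l ≠ i}, ∑ j, ‖b l j‖ ^ 2 = ∏ l, ∑ j, ‖a l j‖ ^ 2 := by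
    rw [← hba]
  simp only [hprod, Pi.star_apply, norm_star] at hbound
  rw [hform]
  rcases hR0.eq_or_lt with hR0 | hRpos
  · rw [← hR0]
    exact mul_nonneg hc (Finset.prod_nonneg fun l _ => sum_norm_sq_nonneg (a l))
  · refine le_of_mul_le_mul_left ?_ hRpos
    calc R * R = R ^ 2 := (sq R).symm
      _ ≤ c * (R * ∏ l, ∑ j, ‖a l j‖ ^ 2) := hbound
      _ = R * (c * ∏ l, ∑ j, ‖a l j‖ ^ 2) := mul_left_comm _ _ _

end PartialTrace

section ReducedTypeProj

variable {P α : Type} [Fintype P] [DecidableEq P] [DecidableEq α]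

theorem card_subtype_ne_add_one (i : P) : Fintype.card {l // l ≠ i} + 1 = Fintype.card P := by
  rw [Fintype.card_subtype_compl, Fintype.card_subtype_eq,
    Nat.sub_add_cancel (Fintype.card_pos_iff.mpr ⟨i⟩)]

theorem occ_piSplitAt_symm (i : P) (s : α) (x : {l : P // l ≠ i} → α) :
    occ ((Equiv.piSplitAt i fun _ => α).symm (s, x)) = occ x + Pi.single s 1 := by
  ext j
  simp only [occ, Finset.card_filter, Pi.add_apply, Pi.single_apply, eq_comm (a := j)]
  rw [Fintype.sum_eq_add_sum_subtype_ne _ i, add_comm]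
  congr 1
  · exact Finset.sum_congr rfl fun l _ => by simp [l.2]
  · simp

theorem sub_single_ne_sub_single {k : α → ℕ} {s t : α} (hst : s ≠ t) (hs : k s ≠ 0) :
    k - Pi.single s 1 ≠ k - Pi.single t 1 := fun h => by
  have := congrFun h s
  simp only [Pi.sub_apply, Pi.single_eq_same, Pi.single_eq_of_ne hst] at this
  omega

theorem exists_eq_add_single {k : α → ℕ} {s : α} (hs : k s ≠ 0) :
    ∃ k' : α → ℕ, k = k' + Pi.single s 1 := by
  refine ⟨k - Pi.single s 1, (tsub_add_cancel_of_le fun j => ?_).symm⟩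
  rcases eq_or_ne j s with rfl | hj
  · simpa [Nat.one_le_iff_ne_zero] using hs
  · simp [hj]

variable [Fintype α]

theorem sum_add_single (k : α → ℕ) (s : α) :
    ∑ j, (k + Pi.single s 1 : α → ℕ) j = ∑ j, k j + 1 := by
  simp [Finset.sum_add_distrib]

theorem prod_pow_add_single (q : α → ℝ) (k : α → ℕ) (s : α) :
    ∏ j, q j ^ (k + Pi.single s 1 : α → ℕ) j = q s * ∏ j, q j ^ k j := by
  simp only [Pi.add_apply, pow_add, Finset.prod_mul_distrib, Pi.single_apply, pow_ite, pow_one,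
    pow_zero, Finset.prod_ite_eq', Finset.mem_univ, if_true, mul_comm]

theorem prod_factorial_add_single (k : α → ℕ) (s : α) :
    ∏ j, ((k + Pi.single s 1 : α → ℕ) j)! = (k s + 1) * ∏ j, (k j)! := by
  have hterm : ∀ j, ((k + Pi.single s 1 : α → ℕ) j)! =
      (if j = s then k j + 1 else 1) * (k j)! := fun j => by
    rcases eq_or_ne j s with rfl | hj
    · simp [Nat.factorial_succ]
    · simp [hj]
  simp only [hterm, Finset.prod_mul_distrib, Finset.prod_ite_eq', Finset.mem_univ, if_true]

theorem card_words_add_single (i : P) {k : α → ℕ} (hk : ∑ j, k j = Fintype.card {l // l ≠ i})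
    (s : α) : (k s + 1) * (words P (k + Pi.single s 1)).card =
      Fintype.card P * (words {l // l ≠ i} k).card := by
  have hsum : ∑ j, (k + Pi.single s 1 : α → ℕ) j = Fintype.card P := by
    rw [sum_add_single, hk, card_subtype_ne_add_one]
  have hfact := Nat.multinomial_spec Finset.univ (k + Pi.single s 1)
  rw [prod_factorial_add_single, sum_add_single, Nat.factorial_succ,
    ← Nat.multinomial_spec Finset.univ k, ← sum_add_single k s, hsum] at hfact
  rw [card_words hk, card_words hsum]
  have hpos : 0 < ∏ j, (k j)! := Finset.prod_pos fun j _ => Nat.factorial_pos (k j)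
  refine Nat.eq_of_mul_eq_mul_left hpos ?_
  linarith

theorem slice_typeVec_add_single (i : P) {k : α → ℕ} (hk : ∑ j, k j = Fintype.card {l // l ≠ i})
    (s : α) : slice i (typeVec P (k + Pi.single s 1)) s =
      √((k s + 1 : ℝ) / Fintype.card P) • typeVec {l // l ≠ i} k := by
  have hcard : ((k s : ℝ) + 1) * (words P (k + Pi.single s 1)).card =
      Fintype.card P * (words {l // l ≠ i} k).card := by
    exact_mod_cast card_words_add_single i hk s
  ext x
  simp only [slice, typeVec, occ_piSplitAt_symm, add_left_inj, Pi.smul_apply, Complex.real_smul]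
  split_ifs
  · rw [← Complex.ofReal_mul, one_div, one_div, ← Real.sqrt_inv, ← Real.sqrt_inv,
      ← Real.sqrt_mul (by positivity)]
    rw [← div_eq_mul_inv, div_div, ← hcard, div_mul_cancel_left₀ (Nat.cast_add_one_ne_zero _)]
  · rw [mul_zero]

theorem slice_typeVec_of_eq_zero (i : P) {k : α → ℕ} {s : α} (hs : k s = 0) :
    slice i (typeVec P k) s = 0 := by
  ext x
  refine if_neg fun h => ?_
  have := congrFun h s
  simp [occ_piSplitAt_symm, hs] at this

theorem reduced_typeProj (i : P) {k : α → ℕ} (hk : ∑ j, k j = Fintype.card P) :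
    reduced i (typeProj P k) = ∑ s, ((k s : ℝ) / Fintype.card P) •
      typeProj {l : P // l ≠ i} (k - Pi.single s 1) := by
  rw [typeProj, reduced_vecMulVec_star]
  refine Finset.sum_congr rfl fun s _ => ?_
  rcases eq_or_ne (k s) 0 with hs | hs
  · rw [slice_typeVec_of_eq_zero i hs, Matrix.zero_vecMulVec, hs, Nat.cast_zero, zero_div,
      zero_smul]
  obtain ⟨k', rfl⟩ := exists_eq_add_single hs
  rw [sum_add_single, ← card_subtype_ne_add_one i, Nat.add_right_cancel_iff] at hk
  rw [slice_typeVec_add_single i hk, add_tsub_cancel_right, typeProj, star_smul,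
    Matrix.smul_vecMulVec, Matrix.vecMulVec_smul, smul_smul, star_trivial,
    Real.mul_self_sqrt (by positivity), Pi.add_apply, Pi.single_eq_same, Nat.cast_add_one]

end ReducedTypeProj

section ReducedCertificate

variable {P α : Type} [Fintype P] [Fintype α] [DecidableEq P] [DecidableEq α] {k : α → ℕ}

theorem sum_sub_single (i : P) (hk : ∑ j, k j = Fintype.card P) {s : α} (hs : k s ≠ 0) :
    ∑ j, (k - Pi.single s 1 : α → ℕ) j = Fintype.card {l // l ≠ i} := by
  obtain ⟨k', rfl⟩ := exists_eq_add_single hs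
  rw [sum_add_single, ← card_subtype_ne_add_one i, Nat.add_right_cancel_iff] at hk
  rwa [add_tsub_cancel_right]

theorem card_words_sub_single_mul_prod_pow (i : P) (hk : ∑ j, k j = Fintype.card P) {s : α}
    (hs : k s ≠ 0) :
    (words {l // l ≠ i} (k - Pi.single s 1)).card *
        ∏ j, ((k j : ℝ) / Fintype.card P) ^ (k - Pi.single s 1 : α → ℕ) j = typeOverlap P k := by
  obtain ⟨k', rfl⟩ := exists_eq_add_single hs
  have : Nonempty P := ⟨i⟩
  have hcard := card_words_add_single i (s := s) (by simpa using sum_sub_single i hk hs)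
  have hcard' : ((k' s : ℝ) + 1) * (words P (k' + Pi.single s 1)).card =
      Fintype.card P * (words {l // l ≠ i} k').card := by exact_mod_cast hcard
  rw [typeOverlap, prod_pow_add_single, add_tsub_cancel_right, ← mul_assoc]
  congr 1
  rw [Pi.add_apply, Pi.single_eq_same, Nat.cast_add_one, mul_div_assoc', mul_comm _ (_ + 1 : ℝ),
    hcard', mul_div_cancel_left₀ _ (by positivity)]

theorem spectralResolution_reduced_typeProj (i : P) (hk : ∑ j, k j = Fintype.card P) :
    SpectralResolution (reduced i (typeProj P k)) (fun s => (k s : ℝ) / Fintype.card P)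
      fun s => typeProj {l // l ≠ i} (k - Pi.single s 1) where
  sum_eq := reduced_typeProj i hk
  trace_eq s hs := (isState_typeProj (sum_sub_single i hk fun h => hs (by simp [h]))).2
  mul_eq s := by
    rw [reduced_typeProj i hk, Matrix.sum_mul, Finset.sum_eq_single s]
    · rw [Matrix.smul_mul]
      rcases eq_or_ne (k s) 0 with hs | hs
      · simp [hs]
      · rw [typeProj_mul_self (sum_sub_single i hk hs)]
    · intro t _ hts
      rw [Matrix.smul_mul]
      rcases eq_or_ne (k t) 0 with ht | ht
      · simp [ht]
      · rw [typeProj_mul_typeProj_of_ne (sub_single_ne_sub_single hts ht), smul_zero]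
    · exact fun hs => absurd (Finset.mem_univ s) hs

theorem overlapCertificate_reduced_typeProj (i : P) (hk : ∑ j, k j = Fintype.card P) :
    OverlapCertificate (ι := fun _ : {l // l ≠ i} => α) (reduced i (typeProj P k))
      (dephasedProduct {l // l ≠ i} fun j => (k j : ℝ) / Fintype.card P) (typeOverlap P k) where
  isState := isState_reduced i (isState_typeProj hk)
  entry_nonneg x y := Finset.sum_nonneg fun _ _ => typeProj_entry_nonneg k _ _
  bound := (productBound_typeProj hk).reduced_vecMulVec_star (typeOverlap_pos hk).le i
  mem_SEP :=
    have : Nonempty P := ⟨i⟩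
    dephasedProduct_mem_SEP (fun j => by positivity) (sum_div_eq_one Fintype.card_ne_zero hk)
  mul_eq := by
    rw [reduced_typeProj i hk, Matrix.mul_sum, Finset.smul_sum]
    refine Finset.sum_congr rfl fun s _ => ?_
    rcases eq_or_ne (k s) 0 with hs | hs
    · simp [hs]
    · rw [Matrix.mul_smul, dephasedProduct_mul_typeProj,
        card_words_sub_single_mul_prod_pow i hk hs, smul_comm]

end ReducedCertificate

section Dicke

variable {N d : ℕ} {k : Fin d → ℕ}

theorem card_words_fin (hk : ∑ j, k j = N) :
    ((words (Fin N) k).card : ℝ) = (N ! : ℝ) / ∏ j, ((k j)! : ℝ) := by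
  have hspec := Nat.multinomial_spec Finset.univ k
  rw [← card_words (P := Fin N) (by rw [hk, Fintype.card_fin]), hk] at hspec
  rw [← hspec, Nat.cast_mul, Nat.cast_prod, mul_div_cancel_left₀ _ (by positivity)]

theorem dicke_eq_typeProj (hk : ∑ j, k j = N) : dicke N k = typeProj (Fin N) k := by
  have hvec : dickeVec N k = typeVec (Fin N) k := by
    ext x
    simp only [dickeVec, typeVec, card_words_fin hk, funext_iff, occ]
  rw [dicke, hvec, typeProj]

theorem dickeValue_eq_neg_logb_typeOverlap (hk : ∑ j, k j = N) :
    dickeValue N k = -Real.logb 2 (typeOverlap (Fin N) k) := by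
  rw [dickeValue, typeOverlap, card_words_fin hk, Fintype.card_fin]

theorem overlapCertificate_dicke (hN : N ≠ 0) (hk : ∑ j, k j = N) :
    OverlapCertificate (dicke N k) (dephasedProduct (Fin N) fun j => (k j : ℝ) / N)
      (typeOverlap (Fin N) k) := by
  have : NeZero N := ⟨hN⟩
  have h := overlapCertificate_typeProj (P := Fin N) (hk.trans (Fintype.card_fin N).symm)
  rwa [← dicke_eq_typeProj hk, Fintype.card_fin] at h

theorem dicke_mul_self (hk : ∑ j, k j = N) : dicke N k * dicke N k = dicke N k := by
  rw [dicke_eq_typeProj hk, typeProj_mul_self (hk.trans (Fintype.card_fin N).symm)]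

theorem overlapCertificate_reduced_dicke (hk : ∑ j, k j = N) (i : Fin N) :
    OverlapCertificate (reduced i (dicke N k))
      (dephasedProduct {l // l ≠ i} fun j => (k j : ℝ) / N) (typeOverlap (Fin N) k) := by
  have h := overlapCertificate_reduced_typeProj i (hk.trans (Fintype.card_fin N).symm)
  rwa [← dicke_eq_typeProj hk, Fintype.card_fin] at h

theorem vonNeumannEntropy_reduced_dicke (hk : ∑ j, k j = N) (i : Fin N) :
    vonNeumannEntropy (reduced i (dicke N k)) = shannonEntropy fun j => (k j : ℝ) / N := by
  have hk' : ∑ j, k j = Fintype.card (Fin N) := hk.trans (Fintype.card_fin N).symm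
  rw [dicke_eq_typeProj hk, (spectralResolution_reduced_typeProj i hk').vonNeumannEntropy_eq
    (isState_reduced i (isState_typeProj hk')).1.isHermitian, shannonEntropy, Fintype.card_fin]

end Dicke

end MultipartiteEntanglement

end

theorem mainTheorem9 (N d : ℕ) (hN : 1 ≤ N) (k : Fin d → ℕ) (hk : ∑ j, k j = N) :
    -- additivity of the three measures of the generalized Dicke state
    (IsStrongAdditive GM (dicke N k) ∧ IsAdditive REE (dicke N k) ∧ IsAdditive LGR (dicke N k)) ∧
    -- the three asymptotic measures
    (HasAsymptotic LGR (dicke N k) (dickeValue N k) ∧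
      HasAsymptotic REE (dicke N k) ((dickeValue N k : ℝ) : EReal) ∧
      HasAsymptotic GM (dicke N k) (dickeValue N k)) ∧
    -- the reduced states, whichever party is traced out
    (∀ i : Fin N,
      IsAdditive REE (reduced i (dicke N k)) ∧
      REE (fun _ : {l : Fin N // l ≠ i} => Fin d) (reduced i (dicke N k)) =
        ((dickeValue N k - shannonEntropy (fun j => (k j : ℝ) / (N : ℝ)) : ℝ) : EReal) ∧
      HasAsymptotic REE (reduced i (dicke N k))
        ((dickeValue N k - shannonEntropy (fun j => (k j : ℝ) / (N : ℝ)) : ℝ) : EReal)) := by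
  have hdicke := overlapCertificate_dicke (Nat.one_le_iff_ne_zero.mp hN) hk
  have hpure := dicke_mul_self hk
  have hvalue := dickeValue_eq_neg_logb_typeOverlap hk
  have hGM : GM _ (dicke N k) = dickeValue N k := hdicke.GM_eq.trans hvalue.symm
  have hLGR : LGR _ (dicke N k) = dickeValue N k := (hdicke.LGR_eq hpure).trans hvalue.symm
  have hREE : REE _ (dicke N k) = ((dickeValue N k : ℝ) : EReal) := by
    rw [hdicke.REE_eq, vonNeumannEntropy_of_mul_self hdicke.isState hpure, neg_zero, zero_sub,
      hvalue]
  refine ⟨⟨isStrongAdditive_GM hdicke.isState hdicke.entry_nonneg, hdicke.isAdditive_REE,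
    hdicke.isAdditive_LGR hpure⟩, ⟨hLGR ▸ hdicke.isAdditive_LGR hpure,
    hREE ▸ hdicke.isAdditive_REE, hGM ▸ hdicke.isAdditive_GM⟩, fun i => ?_⟩
  have hreduced := overlapCertificate_reduced_dicke hk i
  have hREE' : REE _ (reduced i (dicke N k)) =
      ((dickeValue N k - shannonEntropy fun j => (k j : ℝ) / N : ℝ) : EReal) := by
    rw [hreduced.REE_eq, vonNeumannEntropy_reduced_dicke hk i, hvalue, neg_sub_comm]
  exact ⟨hreduced.isAdditive_REE, hREE', hREE' ▸ hreduced.isAdditive_REE⟩
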